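/- Let $R$ be a Noetherian commutative ring with unit; all tensor products are over $R$, and Sweedler notation is used. Let $H$ be a Hopf $R$-algebra with a twisted antipode, i.e. an $R$-linear map $\overline S:H\to H$ with $\sum\overline S(h_2)h_1=\varepsilon(h)1_H=\sum h_2\overline S(h_1)$ for all $h\in H$. The dual $H^*=\mathrm{Hom}_R(H,R)$ is an algebra under convolution $(f\star g)(h)=\sum f(h_1)g(h_2)$ with unit $\varepsilon$, and a right $H$-module by $(fh)(k)=f(hk)$. Let $A$ be an $R$-algebra with a weak left $H$-action $h\otimes a\mapsto ha$ (an $R$-linear map $H\otimes A\to A$ such that $a\mapsto[h\mapsto ha]$ is an algebra morphism from $A$ to $\mathrm{Hom}_R(H,A)$ with convolution, and $1_Ha=a$), and let $\sigma:H\otimes H\to A$ be $R$-linear such that $A\#_\sigma H$, the module $A\otimes H$ with the multiplication $$(a\#h)(b\#k)=\sum a(h_1b)\sigma(h_2\otimes k_1)\#h_3k_2,$$ is associative with unit $1_A\#1_H$ (a right $H$-crossed product). It is a right $H$-comodule algebra via $\mathrm{id}\otimes\Delta$. Assume that $\sigma$ has a convolution inverse $\sigma^{-1}$ in $\mathrm{Hom}_R(H\otimes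 H,A)$. Let $U\subseteq H^*$ be a right $H$-module subalgebra: an $R$-submodule closed under $\star$ and under the right $H$-action ($\varepsilon\in U$ is not required). For a right $H$-comodule algebra $B$ with coaction $b\mapsto\sum b_{<0>}\otimes b_{<1>}$, let $B\#U$ be $B\otimes U$ with the multiplication $(b\#f)(b'\#g)=\sum bb'_{<0>}\#(fb'_{<1>})\star g$; if $\varepsilon\in U$, it has the unit $1_B\#\varepsilon$. $H$ is a right $H$-comodule algebra via $\Delta$. Let $V\subseteq H^*$ be a right $H$-submodule such that $(V,U)$ is compatible, that is: 1. for all $h\in H$ and $a\in A$, the two maps $H\to A$ $$x\mapsto\sum[\overline S(x_2)a]\,\sigma(\overline S(x_1)\otimes h),\qquad x\mapsto\sum\sigma^{-1}(x_3\otimes\overline S(x_2))\,[x_4a]\,\sigma(x_5\otimes\overline S(x_1)h)$$ lie in the image of $A\otimes V\to\mathrm{Hom}_R(H,A)$, $a\otimes g\mapsto[x\mapsto g(x)a]$; 2. (RL-condition) for every $g\in V$ there are finitely many $h_j\in H$ and $g_j\in U$ such that $\sum g(k_1)k_2=\sum_j\sum h_jk_1g_j(k_2)$ for all $k\in H$.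 View $U$ as a submodule of the module $R^H$ of all maps $H\to R$. For a submodule $K\subseteq M$ and an $R$-module $N$, call $K\subseteq M$ $N$-pure if $K\otimes N\to M\otimes N$ is injective, and pure if it is $N$-pure for all $N$. (i) If $U\subseteq R^H$ is $A\otimes H$-pure, then there is an isomorphism of $R$-algebras $$(A\#_\sigma H)\#U\;\cong\;A\otimes(H\#U),$$ which preserves units if $\varepsilon\in U$. (ii) Let $H^\circ$ be the set of all $f\in H^*$ for which the $H$-sub-bimodule $HfH$ of $H^*$ is a finitely generated $R$-module. If $H^\circ\subseteq R^H$ is pure (i.e. $H$ is a Hopf $\alpha$-algebra) and $U\subseteq H^\circ$ is a sub-bialgebra (a pure submodule of $H^\circ$ with $\varepsilon\in U$, closed under $\star$ and such that for every $f\in U$ the function $(h,k)\mapsto f(hk)$ is given by an element of $U\otimes U$), then $U\subseteq R^H$ is $A\otimes H$-pure, so that (i) applies. -/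

import Mathlib

open scoped TensorProduct
open Coalgebra WithConv

universe u v w x

noncomputable section

namespace HopfDuality

/-! ### Sweedler sums and convolution -/

section Coalgebras

variable {R : Type u} {C : Type v} [CommRing R] [AddCommGroup C] [Module R C] [Coalgebra R C]

/-- For a bilinear map `f`, the linear map `c ↦ ∑ f c₁ c₂`. -/
def sweedler {M : Type w} [AddCommGroup M] [Module R M] (f : C →ₗ[R] C →ₗ[R] M) : C →ₗ[R] M :=
  TensorProduct.lift f ∘ₗ comul

/-- Any expression `comul c = ∑ left i ⊗ right i` computes the Sweedler sum. -/
theorem sweedler_eq_sum {M : Type w} [AddCommGroup M] [Module R M] {ι : Type x}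
    (f : C →ₗ[R] C →ₗ[R] M) {c : C} (r : Coalgebra.Repr R c ι) :
    sweedler f c = ∑ i ∈ r.index, f (r.left i) (r.right i) := by
  simp [sweedler, ← r.eq]

/-- The convolution product `(f ⋆ g)(c) = ∑ f(c₁) g(c₂)` on `Hom_R(C, A)`. -/
def conv {A : Type w} [Ring A] [Algebra R A] (f g : C →ₗ[R] A) : C →ₗ[R] A :=
  (toConv f * toConv g).ofConv

/-- `f` and `g` are inverse to each other in the algebra `(Hom_R(C, A), ⋆)`, whose unit is
`c ↦ ε(c) 1`. -/
def IsConvInverse {A : Type w} [Ring A] [Algebra R A] (f g : C →ₗ[R] A) : Prop :=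
  toConv f * toConv g = 1 ∧ toConv g * toConv f = 1

end Coalgebras

/-- The dual module `H* = Hom_R(H, R)`; if `H` is a coalgebra, it carries the convolution
product, with unit `ε`. -/
abbrev Dual (R : Type u) (H : Type v) [CommRing R] [AddCommGroup H] [Module R H] : Type _ :=
  WithConv (H →ₗ[R] R)

/-! ### Purity -/

section Purity

variable {R : Type u} [CommRing R] {M : Type v} [AddCommGroup M] [Module R M]

/-- The submodule `K ⊆ M` is `N`-pure: `K ⊗ N → M ⊗ N` is injective. -/
def IsPureFor (K : Submodule R M) (N : Type w) [AddCommGroup N] [Module R N] : Prop :=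
  Function.Injective (K.subtype.rTensor N)

/-- `K ⊆ M` is pure: it is `N`-pure for every `R`-module `N` (of universe `w`; every universe that
contains, up to isomorphism, the finitely generated `R`-modules gives the same notion). -/
def IsPure (K : Submodule R M) : Prop :=
  ∀ (N : Type w) [AddCommGroup N] [Module R N], IsPureFor K N

end Purity

/-- A submodule of `H*`, regarded as a submodule of the module `R^H` of all functions `H → R`. -/
def inFunctions {R : Type u} {H : Type v} [CommRing R] [AddCommGroup H] [Module R H]
    (U : Submodule R (Dual R H)) : Submodule R (H → R) :=
  U.map (LinearMap.ltoFun R H R R ∘ₗ (WithConv.linearEquiv R (H →ₗ[R] R)).toLinearMap)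

/-! ### The finite dual -/

section FiniteDual

variable (R : Type u) (H : Type v) [CommRing R] [Ring H] [Algebra R H]

/-- The functional `h f k`, that is `x ↦ f (k x h)`, as a linear function of `f`. -/
def biact (h k : H) : Dual R H →ₗ[R] Dual R H where
  toFun f := toConv (f.ofConv ∘ₗ LinearMap.mulLeft R k ∘ₗ LinearMap.mulRight R h)
  map_add' f g := by ext; simp
  map_smul' r f := by ext; simp

/-- The sub-bimodule `H f H` of `H*` generated by `f`. -/
def bimoduleSpan (f : Dual R H) : Submodule R (Dual R H) :=
  Submodule.span R (Set.range fun p : H × H => biact R H p.1 p.2 f)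

/-- `H° = {f ∈ H* | H f H is a finitely generated R-module}`, for `R` Noetherian. -/
def finiteDual [IsNoetherianRing R] : Submodule R (Dual R H) where
  carrier := {f | (bimoduleSpan R H f).FG}
  zero_mem' := by
    have : bimoduleSpan R H 0 = ⊥ := by
      rw [bimoduleSpan, Submodule.span_eq_bot]
      rintro _ ⟨p, rfl⟩
      simp
    simpa [this] using Submodule.fg_bot
  add_mem' := by
    intro f g hf hg
    have hfg : (bimoduleSpan R H f ⊔ bimoduleSpan R H g).FG := Submodule.FG.sup hf hg
    refine Submodule.FG.of_le hfg (Submodule.span_le.2 ?_)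
    rintro _ ⟨p, rfl⟩
    simp only [map_add]
    exact Submodule.add_mem_sup (Submodule.subset_span ⟨p, rfl⟩) (Submodule.subset_span ⟨p, rfl⟩)
  smul_mem' := by
    intro r f hf
    refine Submodule.FG.of_le hf (Submodule.span_le.2 ?_)
    rintro _ ⟨p, rfl⟩
    simp only [map_smul]
    exact Submodule.smul_mem _ _ (Submodule.subset_span ⟨p, rfl⟩)

/-- `H` is an `α`-algebra: `H° ⊆ R^H` is pure. -/
def IsAlphaAlgebra [IsNoetherianRing R] : Prop :=
  IsPure.{u, max u v, w} (inFunctions (finiteDual R H))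

end FiniteDual

/-! ### Right module subalgebras of the dual -/

section Bialgebras

variable (R : Type u) (H : Type v) [CommRing R] [Ring H] [Bialgebra R H]

/-- The right regular action of `H` on `H*`: `(f h)(k) = f (h k)`. -/
def dualAct : Dual R H →ₗ[R] H →ₗ[R] Dual R H :=
  LinearMap.mk₂ R (fun f h => toConv (f.ofConv ∘ₗ LinearMap.mulLeft R h))
    (fun f g h => by ext; simp) (fun r f h => by ext; simp)
    (fun f h k => by ext; simp [add_mul]) (fun r f h => by ext; simp)

/-- A right `H`-module subalgebra `U` of `H*` (not required to contain the unit `ε` of `H*`). -/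
structure RightModuleSubalgebra extends NonUnitalSubalgebra R (Dual R H) where
  act_mem : ∀ f ∈ carrier, ∀ h : H, dualAct R H f h ∈ carrier

variable {R H}

/-- The underlying `R`-submodule of `H*`. -/
abbrev RightModuleSubalgebra.sub (U : RightModuleSubalgebra R H) : Submodule R (Dual R H) :=
  U.toNonUnitalSubalgebra.toSubmodule

/-- The right action of `H` on `U`. -/
def RightModuleSubalgebra.act (U : RightModuleSubalgebra R H) :
    U.toNonUnitalSubalgebra →ₗ[R] H →ₗ[R] U.toNonUnitalSubalgebra :=
  LinearMap.mk₂ R (fun f h => ⟨dualAct R H f h, U.act_mem f f.2 h⟩)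
    (fun f g h => by ext; simp) (fun r f h => by ext; simp)
    (fun f h k => by ext; simp) (fun r f h => by ext; simp)

/-- `f ⇀ k = ∑ k₁ f(k₂)`. -/
def leftHit (f : Dual R H) : H →ₗ[R] H :=
  (TensorProduct.rid R H).toLinearMap ∘ₗ f.ofConv.lTensor H ∘ₗ comul

/-- `k ↼ f = ∑ f(k₁) k₂`. -/
def rightHit (f : Dual R H) : H →ₗ[R] H :=
  (TensorProduct.lid R H).toLinearMap ∘ₗ f.ofConv.rTensor H ∘ₗ comul

/-- The map `λ : H ⊗ U → End_R(H)`, `h ⊗ g ↦ [k ↦ h (g ⇀ k)]`. -/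
def lambda (U : RightModuleSubalgebra R H) :
    H ⊗[R] U.toNonUnitalSubalgebra →ₗ[R] (H →ₗ[R] H) :=
  TensorProduct.lift <| LinearMap.mk₂ R
    (fun h g => LinearMap.mulLeft R h ∘ₗ leftHit (g : Dual R H))
    (fun h k g => by ext; simp [add_mul]) (fun r h g => by ext; simp)
    (fun h f g => by ext; simp [leftHit, LinearMap.lTensor_add, mul_add])
    (fun r h g => by ext; simp [leftHit, LinearMap.lTensor_smul])

/-- The RL-condition of `(V, U)` with respect to `H`: for every `g ∈ V` the map `k ↦ k ↼ g` is of
the form `k ↦ ∑ hⱼ (gⱼ ⇀ k)` with `hⱼ ∈ H`, `gⱼ ∈ U`. -/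
def RLCondition (V : Submodule R (Dual R H)) (U : RightModuleSubalgebra R H) : Prop :=
  ∀ g ∈ V, rightHit g ∈ LinearMap.range (lambda U)

/-- `U` is a sub-bialgebra of the bialgebra `H°` (`R` Noetherian, `H° ⊆ R^H` pure): it is a pure
submodule of `H°`, is closed under convolution, contains the unit `ε`, and the comultiplication of
`H°`, which sends `f` to the tensor representing `(h, k) ↦ f (h k)`, maps `U` into `U ⊗ U`. -/
structure IsSubbialgebraOfFiniteDual [IsNoetherianRing R] (U : RightModuleSubalgebra R H) :
    Prop where
  le : U.sub ≤ finiteDual R H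
  pure : IsPure.{u, max u v, w} (M := finiteDual R H) (U.sub.submoduleOf (finiteDual R H))
  one_mem : (1 : Dual R H) ∈ U.sub
  comul_mem : ∀ f ∈ U.sub, ∃ (n : ℕ) (p q : Fin n → Dual R H),
    (∀ i, p i ∈ U.sub ∧ q i ∈ U.sub) ∧ ∀ h k : H, f (h * k) = ∑ i, p i h * q i k

/-- A twisted antipode, i.e. an antipode of `H^op`:
`∑ S(h₂) h₁ = ε(h) 1 = ∑ h₂ S(h₁)` for all `h`. -/
structure IsTwistedAntipode (S : H →ₗ[R] H) : Prop where
  left : ∀ h : H, LinearMap.mul' R H (TensorProduct.comm R H H (S.lTensor H (comul h))) =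
    algebraMap R H (counit h)
  right : ∀ h : H, LinearMap.mul' R H (TensorProduct.comm R H H (S.rTensor H (comul h))) =
    algebraMap R H (counit h)

end Bialgebras

/-! ### Crossed products -/

section CrossedProducts

variable {R : Type u} {H : Type v} {A : Type w} [CommRing R] [Ring H] [Bialgebra R H] [Ring A]
  [Algebra R A]

/-- A weak left action `h ⊗ a ↦ act h a`: the map `A → Hom_R(H, A)`, `a ↦ [h ↦ act h a]`, is a
morphism of algebras for the convolution product, and `1` acts as the identity. -/
structure IsWeakAction (act : H →ₗ[R] A →ₗ[R] A) : Prop where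
  map_mul : ∀ a b : A, toConv (act.flip (a * b)) = toConv (act.flip a) * toConv (act.flip b)
  map_one : toConv (act.flip 1) = 1
  one_act : ∀ a : A, act 1 a = a

/-- The map `h ⊗ k ↦ ∑ σ(h₁ ⊗ k₁) ⊗ h₂ k₂`. -/
def cocycleMul (σ : H ⊗[R] H →ₗ[R] A) : H ⊗[R] H →ₗ[R] A ⊗[R] H :=
  TensorProduct.map σ (LinearMap.mul' R H) ∘ₗ comul

/-- The left multiplication of `A` on the first factor, `a ⊗ (b ⊗ h) ↦ a b ⊗ h`. -/
def leftMul : A ⊗[R] (A ⊗[R] H) →ₗ[R] A ⊗[R] H :=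
  (LinearMap.mul' R A).rTensor H ∘ₗ (TensorProduct.assoc R A A H).symm.toLinearMap

/-- For given `a`, the bilinear map
`(h, h') ↦ [b ⊗ k ↦ ∑ a (act h b) σ(h'₁ ⊗ k₁) ⊗ h'₂ k₂]`. -/
def crossedAux (act : H →ₗ[R] A →ₗ[R] A) (σ : H ⊗[R] H →ₗ[R] A) (a : A) :
    H →ₗ[R] H →ₗ[R] (A ⊗[R] H →ₗ[R] A ⊗[R] H) :=
  LinearMap.mk₂ R
    (fun h h' => leftMul ∘ₗ TensorProduct.map (LinearMap.mulLeft R a ∘ₗ act h)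
      (cocycleMul σ ∘ₗ TensorProduct.mk R H H h'))
    (fun h k h' => by ext; simp [mul_add, TensorProduct.add_tmul])
    (fun r h h' => by ext; simp [← TensorProduct.smul_tmul'])
    (fun h h' k' => by ext; simp [TensorProduct.tmul_add])
    (fun r h h' => by ext; simp)

/-- The multiplication
`(a # h)(b # k) = ∑ a (act h₁ b) σ(h₂ ⊗ k₁) # h₃ k₂` on `A ⊗ H`. -/
def crossedMul (act : H →ₗ[R] A →ₗ[R] A) (σ : H ⊗[R] H →ₗ[R] A) :
    A ⊗[R] H →ₗ[R] A ⊗[R] H →ₗ[R] A ⊗[R] H :=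
  TensorProduct.lift <| LinearMap.mk₂ R (fun a h => sweedler (crossedAux act σ a) h)
    (fun a b h => by
      simp only [sweedler_eq_sum _ (ℛ R h), ← Finset.sum_add_distrib]
      refine Finset.sum_congr rfl fun i _ => ?_
      ext; simp [crossedAux, add_mul, TensorProduct.add_tmul])
    (fun r a h => by
      simp only [sweedler_eq_sum _ (ℛ R h), Finset.smul_sum]
      refine Finset.sum_congr rfl fun i _ => ?_
      ext; simp [crossedAux, ← TensorProduct.smul_tmul'])
    (fun a h k => map_add _ _ _) (fun r a h => map_smul _ _ _)

/-- The Sweedler formula for the multiplication, for any expressions of the iterated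
comultiplication of `h` and of the comultiplication of `k`. -/
theorem crossedMul_tmul {ι κ μ : Type x} (act : H →ₗ[R] A →ₗ[R] A) (σ : H ⊗[R] H →ₗ[R] A)
    (a b : A) (h k : H) (r : Coalgebra.Repr R h ι) (r' : ∀ i, Coalgebra.Repr R (r.right i) κ)
    (s : Coalgebra.Repr R k μ) :
    crossedMul act σ (a ⊗ₜ[R] h) (b ⊗ₜ[R] k) =
      ∑ i ∈ r.index, ∑ j ∈ (r' i).index, ∑ l ∈ s.index,
        (a * act (r.left i) b * σ ((r' i).left j ⊗ₜ[R] s.left l)) ⊗ₜ[R]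
          ((r' i).right j * s.right l) := by
  change sweedler (crossedAux act σ a) h (b ⊗ₜ[R] k) = _
  rw [sweedler_eq_sum _ r, LinearMap.sum_apply]
  refine Finset.sum_congr rfl fun i _ => ?_
  rw [Finset.sum_comm]
  simp [crossedAux, cocycleMul, TensorProduct.comul_tmul, ← (r' i).eq, ← s.eq,
    TensorProduct.tmul_sum, TensorProduct.sum_tmul, leftMul]

/-- The underlying module `A ⊗ H` of `A #_σ H`, with the (a priori neither associative nor unital)
multiplication `crossedMul`. -/
def CrossedProduct (_act : H →ₗ[R] A →ₗ[R] A) (_σ : H ⊗[R] H →ₗ[R] A) : Type (max v w) :=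
  A ⊗[R] H

namespace CrossedProduct

variable (act : H →ₗ[R] A →ₗ[R] A) (σ : H ⊗[R] H →ₗ[R] A)

instance : AddCommGroup (CrossedProduct act σ) := inferInstanceAs (AddCommGroup (A ⊗[R] H))

instance : Module R (CrossedProduct act σ) := inferInstanceAs (Module R (A ⊗[R] H))

instance : NonUnitalNonAssocRing (CrossedProduct act σ) where
  mul x y := crossedMul act σ x y
  left_distrib x y z := map_add (crossedMul act σ x) y z
  right_distrib x y z := LinearMap.map_add₂ (crossedMul act σ) x y z
  zero_mul x := LinearMap.map_zero₂ (crossedMul act σ) x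
  mul_zero x := map_zero (crossedMul act σ x)

instance : IsScalarTower R (CrossedProduct act σ) (CrossedProduct act σ) where
  smul_assoc r x y := LinearMap.map_smul₂ (crossedMul act σ) r x y

instance : SMulCommClass R (CrossedProduct act σ) (CrossedProduct act σ) where
  smul_comm r x y := (map_smul (crossedMul act σ x) r y).symm

instance : One (CrossedProduct act σ) where
  one := ((1 : A) ⊗ₜ[R] (1 : H) : A ⊗[R] H)

/-- The right coaction `id ⊗ Δ : A #_σ H → (A #_σ H) ⊗ H`. -/
def coaction : CrossedProduct act σ →ₗ[R] CrossedProduct act σ ⊗[R] H :=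
  ((TensorProduct.assoc R A H H).symm.toLinearMap ∘ₗ LinearMap.lTensor A comul :
    A ⊗[R] H →ₗ[R] (A ⊗[R] H) ⊗[R] H)

end CrossedProduct

/-- `A #_σ H` is a right `H`-crossed product: `act` is a weak action, and the multiplication of
`A #_σ H` is associative with unit `1 # 1`. -/
structure IsCrossedProduct (act : H →ₗ[R] A →ₗ[R] A) (σ : H ⊗[R] H →ₗ[R] A) : Prop where
  weak : IsWeakAction act
  mul_assoc : ∀ x y z : CrossedProduct act σ, x * y * z = x * (y * z)
  one_mul : ∀ x : CrossedProduct act σ, 1 * x = x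
  mul_one : ∀ x : CrossedProduct act σ, x * 1 = x

/-! ### Compatible pairs -/

/-- `φ(h ⊗ a)(x) = ∑ (act (S x₂) a) σ(S x₁ ⊗ h)`. -/
def phi (S : H →ₗ[R] H) (act : H →ₗ[R] A →ₗ[R] A) (σ : H ⊗[R] H →ₗ[R] A) (h : H) (a : A) :
    H →ₗ[R] A :=
  sweedler <| LinearMap.mk₂ R (fun x₁ x₂ => act (S x₂) a * σ (S x₁ ⊗ₜ h))
    (fun x y z => by simp [TensorProduct.add_tmul, mul_add])
    (fun r x z => by simp [← TensorProduct.smul_tmul'])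
    (fun x y z => by simp [add_mul]) (fun r x z => by simp)

/-- The map `x ↦ ∑ σ'(x₂ ⊗ S x₁)`. -/
def psiHead (S : H →ₗ[R] H) (σ' : H ⊗[R] H →ₗ[R] A) : H →ₗ[R] A :=
  sweedler <| LinearMap.mk₂ R (fun x₁ x₂ => σ' (x₂ ⊗ₜ S x₁))
    (fun x y z => by simp [TensorProduct.tmul_add]) (fun r x z => by simp)
    (fun x y z => by simp [TensorProduct.add_tmul])
    (fun r x z => by simp [← TensorProduct.smul_tmul'])

/-- `ψ(h ⊗ a)(x) = ∑ σ'(x₃ ⊗ S x₂) (act x₄ a) σ(x₅ ⊗ (S x₁) h)`, where `σ'` is the convolution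
inverse of `σ`. The sum over `x₂, …, x₅` is written as the convolution product of
`y ↦ ∑ σ'(y₂ ⊗ S y₁)`, `y ↦ act y a` and `y ↦ σ(y ⊗ (S x₁) h)`. -/
def psi (S : H →ₗ[R] H) (act : H →ₗ[R] A →ₗ[R] A) (σ σ' : H ⊗[R] H →ₗ[R] A) (h : H) (a : A) :
    H →ₗ[R] A :=
  sweedler <| LinearMap.mk₂ R
    (fun x₁ y => conv (conv (psiHead S σ') (act.flip a))
      (σ ∘ₗ (TensorProduct.mk R H H).flip (S x₁ * h)) y)
    (fun x y z => by simp [conv, add_mul, LinearMap.comp_add, TensorProduct.map_add_right])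
    (fun r x z => by simp [conv, LinearMap.comp_smul])
    (fun x y z => by simp) (fun r x z => by simp)

/-- The canonical map `J : A ⊗ V → Hom_R(H, A)`, `a ⊗ g ↦ [h ↦ g(h) a]`. -/
def canonicalMap (A : Type w) [Ring A] [Algebra R A] (V : Submodule R (Dual R H)) :
    A ⊗[R] V →ₗ[R] (H →ₗ[R] A) :=
  TensorProduct.lift <| LinearMap.mk₂ R (fun a g => (g : Dual R H).ofConv.smulRight a)
    (fun a b g => by ext; simp) (fun r a g => by ext x; simpa using smul_comm _ _ _)
    (fun a f g => by ext; simp [add_smul]) (fun r a g => by ext; simp [mul_smul])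

/-- `(V, U)` is compatible: `φ(H ⊗ A)` and `ψ(H ⊗ A)` are contained in `J(A ⊗ V)` and `(V, U)`
satisfies the RL-condition. (The range of `J` is a submodule, so the first two inclusions can be
stated on the elements `h ⊗ a`, on which `phi` and `psi` are given.) -/
structure IsCompatible (S : H →ₗ[R] H) (act : H →ₗ[R] A →ₗ[R] A) (σ σ' : H ⊗[R] H →ₗ[R] A)
    (V : Submodule R (Dual R H)) (U : RightModuleSubalgebra R H) : Prop where
  phi_mem : ∀ (h : H) (a : A), phi S act σ h a ∈ LinearMap.range (canonicalMap A V)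
  psi_mem : ∀ (h : H) (a : A), psi S act σ σ' h a ∈ LinearMap.range (canonicalMap A V)
  rl : RLCondition V U

end CrossedProducts

/-! ### Smash products `B # U` -/

section Smash

variable {R : Type u} {H : Type v} [CommRing R] [Ring H] [Bialgebra R H]
  {B : Type w} [NonUnitalNonAssocRing B] [Module R B] [IsScalarTower R B B] [SMulCommClass R B B]

/-- For given `b` and `f`, the map `b' ⊗ g ↦ ∑ b b'₀ ⊗ (f b'₁) ⋆ g`, where `∑ b'₀ ⊗ b'₁` is the
coaction `ρ` applied to `b'`. -/
def smashLeft (ρ : B →ₗ[R] B ⊗[R] H) (U : RightModuleSubalgebra R H) (b : B)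
    (f : U.toNonUnitalSubalgebra) :
    B ⊗[R] U.toNonUnitalSubalgebra →ₗ[R] B ⊗[R] U.toNonUnitalSubalgebra :=
  TensorProduct.map (LinearMap.mul R B b)
      (TensorProduct.lift (LinearMap.mul R U.toNonUnitalSubalgebra ∘ₗ U.act f)) ∘ₗ
    (TensorProduct.assoc R B H U.toNonUnitalSubalgebra).toLinearMap ∘ₗ
    ρ.rTensor U.toNonUnitalSubalgebra

/-- The multiplication `(b # f)(b' # g) = ∑ b b'₀ # (f b'₁) ⋆ g` on `B ⊗ U`. -/
def smashMul (ρ : B →ₗ[R] B ⊗[R] H) (U : RightModuleSubalgebra R H) :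
    B ⊗[R] U.toNonUnitalSubalgebra →ₗ[R] B ⊗[R] U.toNonUnitalSubalgebra →ₗ[R]
      B ⊗[R] U.toNonUnitalSubalgebra :=
  TensorProduct.lift <| LinearMap.mk₂ R (smashLeft ρ U)
    (fun b c f => by simp only [smashLeft, map_add, TensorProduct.map_add_left,
      LinearMap.add_comp])
    (fun r b f => by simp only [smashLeft, map_smul, TensorProduct.map_smul_left,
      LinearMap.smul_comp])
    (fun b f g => by
      have h : TensorProduct.lift (LinearMap.mul R U.toNonUnitalSubalgebra ∘ₗ U.act (f + g)) =
          TensorProduct.lift (LinearMap.mul R U.toNonUnitalSubalgebra ∘ₗ U.act f) +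
            TensorProduct.lift (LinearMap.mul R U.toNonUnitalSubalgebra ∘ₗ U.act g) := by
        ext; simp
      rw [smashLeft, h, TensorProduct.map_add_right, LinearMap.add_comp]; rfl)
    (fun r b f => by
      have h : TensorProduct.lift (LinearMap.mul R U.toNonUnitalSubalgebra ∘ₗ U.act (r • f)) =
          r • TensorProduct.lift (LinearMap.mul R U.toNonUnitalSubalgebra ∘ₗ U.act f) := by
        ext; simp
      rw [smashLeft, h, TensorProduct.map_smul_right, LinearMap.smul_comp]; rfl)

/-- The Sweedler formula for the multiplication, for any expression
`ρ b' = ∑ left i ⊗ right i`. -/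
theorem smashMul_tmul {ι : Type x} (ρ : B →ₗ[R] B ⊗[R] H) (U : RightModuleSubalgebra R H)
    (b b' : B) (f g : U.toNonUnitalSubalgebra) (s : Finset ι) (left : ι → B) (right : ι → H)
    (h : ρ b' = ∑ i ∈ s, left i ⊗ₜ[R] right i) :
    smashMul ρ U (b ⊗ₜ[R] f) (b' ⊗ₜ[R] g) =
      ∑ i ∈ s, (b * left i) ⊗ₜ[R] (U.act f (right i) * g) := by
  change smashLeft ρ U b f (b' ⊗ₜ[R] g) = _
  simp [smashLeft, h, TensorProduct.sum_tmul]

/-- The smash product `B # U` of a right `H`-comodule algebra `B` with coaction `ρ` and a right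
`H`-module subalgebra `U` of `H*`. -/
def SmashProduct (_ρ : B →ₗ[R] B ⊗[R] H) (U : RightModuleSubalgebra R H) : Type (max u v w) :=
  B ⊗[R] U.toNonUnitalSubalgebra

namespace SmashProduct

variable (ρ : B →ₗ[R] B ⊗[R] H) (U : RightModuleSubalgebra R H)

instance : AddCommGroup (SmashProduct ρ U) :=
  inferInstanceAs (AddCommGroup (B ⊗[R] U.toNonUnitalSubalgebra))

instance : Module R (SmashProduct ρ U) :=
  inferInstanceAs (Module R (B ⊗[R] U.toNonUnitalSubalgebra))

instance : NonUnitalNonAssocRing (SmashProduct ρ U) where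
  mul x y := smashMul ρ U x y
  left_distrib x y z := map_add (smashMul ρ U x) y z
  right_distrib x y z := LinearMap.map_add₂ (smashMul ρ U) x y z
  zero_mul x := LinearMap.map_zero₂ (smashMul ρ U) x
  mul_zero x := map_zero (smashMul ρ U x)

instance : IsScalarTower R (SmashProduct ρ U) (SmashProduct ρ U) where
  smul_assoc r x y := LinearMap.map_smul₂ (smashMul ρ U) r x y

instance : SMulCommClass R (SmashProduct ρ U) (SmashProduct ρ U) where
  smul_comm r x y := (map_smul (smashMul ρ U x) r y).symm

/-- The element `b # f` of `B # U`. -/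
def mk (b : B) (f : U.toNonUnitalSubalgebra) : SmashProduct ρ U :=
  (b ⊗ₜ[R] f : B ⊗[R] U.toNonUnitalSubalgebra)

end SmashProduct

/-- The smash product `H # U`, where `H` is a comodule over itself through `Δ`. -/
abbrev HopfSmash (U : RightModuleSubalgebra R H) : Type (max u v) :=
  SmashProduct (comul : H →ₗ[R] H ⊗[R] H) U

end Smash

end HopfDuality

end

noncomputable section

namespace HopfDuality

/-! ### Linearity of functions, as a property that `fun_prop` can prove -/

section Linearity

/-! Write B for the crossed product, with γ(h) = 1 # h and A embedded as a # 1. Both algebras act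
faithfully: B # U acts on B by (b # f)v = ∑ b v₀ f(v₁), and A ⊗ (H # U) acts on A ⊗ H, with A acting
by left multiplication and H # U through λ. The isomorphism identifies the two images.

The comparison map is `rightEquiv`, a ⊗ k ↦ δ(k)a, where δ(x) = ∑ σ⁻¹(x₂ ⊗ S x₁) γ(x₃). The map δ is
H-colinear and is the inverse of γ ∘ S for the product with reversed Sweedler indices (`δ_γS`,
`γS_δ`). Hence `rightEquiv` is injective. Both actions commute with right multiplication by A, so
they are determined by their values on δ(k) and on 1 ⊗ k.

Faithfulness: multiplying the value at δ(k₂) by γ(S k₁), or the value at 1 ⊗ k₂ by S(k₁), turns the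
action into evaluation, sending b ⊗ f to k ↦ f(k)b. Evaluation is injective on A ⊗ H ⊗ U because U
is A ⊗ H-pure in R^H and, R being Noetherian, N ⊗ R^X → N^X is injective for every N
(`piScalarRightHom_injective`).

Equality of images: `mul_δ` writes (a # h)δ(k) with coefficients φ, and `δ_mul_ι` writes δ(k)a with
coefficients ψ. By compatibility these coefficients lie in the image of A ⊗ V. They thus turn into
operators k ↦ k ↼ g with g ∈ V, which the RL-condition places in λ(H ⊗ U). Stability of U under H
and ⋆ absorbs the remaining h and f. The resulting linear bijection is multiplicative because both
actions are.

Part (ii) is transitivity of purity along U ⊆ H° ⊆ R^H. -/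

/-- `f` is `R`-linear. -/
@[fun_prop]
structure Lin (R : Type*) {M N : Type*} [CommRing R] [AddCommGroup M] [AddCommGroup N]
    [Module R M] [Module R N] (f : M → N) : Prop where
  add : ∀ x y, f (x + y) = f x + f y
  smul : ∀ (r : R) x, f (r • x) = r • f x

variable {R M N P B : Type*} [CommRing R] [AddCommGroup M] [AddCommGroup N] [AddCommGroup P]
  [Module R M] [Module R N] [Module R P] [Ring B] [Algebra R B]

namespace Lin

/-- The linear map given by a linear function. -/
def toLinearMap {f : M → N} (hf : Lin R f) : M →ₗ[R] N where
  toFun := f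
  map_add' := hf.add
  map_smul' := hf.smul

@[simp] theorem toLinearMap_apply {f : M → N} (hf : Lin R f) (x : M) : hf.toLinearMap x = f x := rfl

@[fun_prop] theorem id' : Lin R (fun x : M => x) := ⟨fun _ _ => rfl, fun _ _ => rfl⟩

@[fun_prop] theorem comp' {f : N → P} {g : M → N} (hf : Lin R f) (hg : Lin R g) :
    Lin R (fun x => f (g x)) :=
  ⟨fun x y => by rw [hg.add, hf.add], fun r x => by rw [hg.smul, hf.smul]⟩

@[fun_prop] theorem coe (f : N →ₗ[R] P) : Lin R (fun x => f x) :=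
  ⟨fun x y => by simp, fun r x => by simp⟩

@[fun_prop] theorem coeAlgHom {C : Type*} [Ring C] [Algebra R C] (f : B →ₐ[R] C) :
    Lin R (fun x => f x) :=
  ⟨fun x y => by simp, fun r x => by simp⟩

@[fun_prop] theorem coe₂ (f : M →ₗ[R] N →ₗ[R] P) (y : N) : Lin R (fun x => f x y) :=
  ⟨fun x y => by simp, fun r x => by simp⟩

@[fun_prop] theorem mul_right {f : M → B} (hf : Lin R f) (b : B) : Lin R (fun x => f x * b) :=
  ⟨fun x y => by rw [hf.add, add_mul], fun r x => by rw [hf.smul, smul_mul_assoc]⟩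

@[fun_prop] theorem mul_left {f : M → B} (hf : Lin R f) (b : B) : Lin R (fun x => b * f x) :=
  ⟨fun x y => by rw [hf.add, mul_add], fun r x => by rw [hf.smul, mul_smul_comm]⟩

@[fun_prop] theorem tmul_right {f : M → N} (hf : Lin R f) (b : P) :
    Lin R (fun x => f x ⊗ₜ[R] b) :=
  ⟨fun x y => by rw [hf.add, TensorProduct.add_tmul],
    fun r x => by rw [hf.smul, TensorProduct.smul_tmul']⟩

@[fun_prop] theorem tmul_left {f : M → N} (hf : Lin R f) (b : P) :
    Lin R (fun x => b ⊗ₜ[R] f x) :=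
  ⟨fun x y => by rw [hf.add, TensorProduct.tmul_add],
    fun r x => by rw [hf.smul, TensorProduct.tmul_smul]⟩

@[fun_prop] theorem smul_right {f : M → R} (hf : Lin R f) (b : P) : Lin R (fun x => f x • b) :=
  ⟨fun x y => by rw [hf.add, add_smul], fun r x => by rw [hf.smul, smul_assoc]⟩

@[fun_prop] theorem smul_left {f : M → N} (hf : Lin R f) (r : R) : Lin R (fun x => r • f x) :=
  ⟨fun x y => by rw [hf.add, smul_add], fun r x => by rw [hf.smul, smul_comm]⟩

end Lin

end Linearity

/-! ### Calculus of Sweedler sums -/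

section SweedlerSums

variable {R H M N : Type*} [CommRing R] [AddCommGroup H] [Module R H] [Coalgebra R H]
  [AddCommGroup M] [Module R M] [AddCommGroup N] [Module R N]

variable (R) in
/-- The Sweedler sum `∑ f(h₁, h₂)` of a function `f`, which is meaningful if `f` is bilinear. -/
def sw {M : Type*} [AddCommGroup M] (h : H) (f : H → H → M) : M :=
  ∑ i ∈ (ℛ R h).index, f ((ℛ R h).left i) ((ℛ R h).right i)

/-- Bilinearity makes the sum independent of the representation of Δ(h) chosen in `sw`. All rules
that change the argument of a Sweedler sum rest on this, which is why they carry linearity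
hypotheses, to be discharged by `fun_prop`. -/
theorem sw_eq_lift {h : H} {f : H → H → M} (h1 : ∀ y, Lin R (fun x => f x y))
    (h2 : ∀ x, Lin R (fun y => f x y)) :
    sw R h f = TensorProduct.lift (LinearMap.mk₂ R f (fun x y z => (h1 z).add x y)
      (fun r x z => (h1 z).smul r x) (fun x y z => (h2 x).add y z)
      (fun r x z => (h2 x).smul r z)) (comul h) := by
  conv_rhs => rw [← (ℛ R h).eq]
  simp [sw]

theorem comul_eq_sw (h : H) : comul (R := R) h = sw R h fun x y => x ⊗ₜ[R] y := (ℛ R h).eq.symm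

theorem sweedler_eq_sw (f : H →ₗ[R] H →ₗ[R] M) (h : H) :
    sweedler f h = sw R h fun x y => f x y := sweedler_eq_sum f (ℛ R h)

@[fun_prop]
theorem Lin.sw_arg {g : N → H} (hg : Lin R g) {f : H → H → M} (h1 : ∀ y, Lin R (fun x => f x y))
    (h2 : ∀ x, Lin R (fun y => f x y)) : Lin R (fun h => sw R (g h) f) := by
  simp only [sw_eq_lift h1 h2]
  constructor
  · intros; simp [hg.add]
  · intros; simp [hg.smul]

@[fun_prop]
theorem Lin.sw_fun {h : H} {f : N → H → H → M} (h1 : ∀ x y, Lin R (fun t => f t x y)) :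
    Lin R (fun t => sw R h (fun x y => f t x y)) := by
  constructor
  · intros; simp [sw, (h1 _ _).add, Finset.sum_add_distrib]
  · intros; simp [sw, (h1 _ _).smul, Finset.smul_sum]

theorem sw_comm {M : Type*} [AddCommGroup M] {G : Type*} [AddCommGroup G] [Module R G]
    [Coalgebra R G] (h : H) (k : G) (f : H → H → G → G → M) :
    sw R h (fun x y => sw R k (fun z w => f x y z w)) =
      sw R k (fun z w => sw R h (fun x y => f x y z w)) :=
  Finset.sum_comm

/-- Coassociativity. -/
theorem sw_assoc {h : H} {f : H → H → H → M} (h1 : ∀ y z, Lin R (fun x => f x y z))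
    (h2 : ∀ x z, Lin R (fun y => f x y z)) (h3 : ∀ x y, Lin R (fun z => f x y z)) :
    sw R h (fun x y => sw R x (fun u v => f u v y)) =
      sw R h (fun x y => sw R y (fun u v => f x u v)) := by
  let F : H →ₗ[R] H →ₗ[R] H →ₗ[R] M := LinearMap.mk₂ R (fun x y => (h3 x y).toLinearMap)
    (fun x y z => by ext; simp [(h1 _ _).add]) (fun r x z => by ext; simp [(h1 _ _).smul])
    (fun x y z => by ext; simp [(h2 _ _).add]) (fun r x z => by ext; simp [(h2 _ _).smul])
  have := congrArg (TensorProduct.lift (TensorProduct.uncurry (.id R) H H M ∘ₗ F))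
    (sum_tmul_tmul_eq (ℛ R h) (fun i => ℛ R _) (fun i => ℛ R _))
  simpa [F, sw] using this

/-- Coassociativity, with a further sum over the left factor. -/
theorem sw_assoc₂ {h : H} {f : H → H → H → H → M} (h1 : ∀ y z w, Lin R (fun x => f x y z w))
    (h2 : ∀ x z w, Lin R (fun y => f x y z w)) (h3 : ∀ x y w, Lin R (fun z => f x y z w))
    (h4 : ∀ x y z, Lin R (fun w => f x y z w)) :
    sw R h (fun u v => sw R v (fun a b => sw R u (fun c d => f c d a b))) =
      sw R h (fun c v => sw R v (fun d w => sw R w (fun a b => f c d a b))) := by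
  simp only [sw_comm (R := R) (H := H) (G := H) (f := fun a b c d => f c d a b)]
  rw [sw_assoc (f := fun u v y => sw R y fun x y => f u v x y)] <;> fun_prop

theorem sw_counit_left {h : H} {f : H → M} (hf : Lin R f) :
    sw R h (fun x y => counit (R := R) x • f y) = f h := by
  have := congrArg hf.toLinearMap (sum_counit_smul (ℛ R h))
  simpa [sw] using this

theorem sw_counit_right {h : H} {f : H → M} (hf : Lin R f) :
    sw R h (fun x y => counit (R := R) y • f x) = f h := by
  have e := congrArg (fun t => hf.toLinearMap (TensorProduct.rid R H t))
    (lTensor_counit_comul (R := R) h)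
  rw [sw_eq_lift (by fun_prop) (by fun_prop)]
  convert e using 1
  · generalize comul (R := R) h = t
    induction t with
    | zero => simp only [map_zero]
    | tmul x y => simp
    | add x y hx hy => simp only [map_add, hx, hy]
  · simp

theorem sw_add {M : Type*} [AddCommGroup M] (h : H) (f g : H → H → M) :
    sw R h (fun x y => f x y + g x y) = sw R h f + sw R h g :=
  Finset.sum_add_distrib

theorem sw_zero {M : Type*} [AddCommGroup M] (h : H) : sw R h (fun _ _ => (0 : M)) = 0 :=
  Finset.sum_const_zero

theorem map_sw {F M N : Type*} [AddCommGroup M] [AddCommGroup N] [FunLike F M N]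
    [AddMonoidHomClass F M N] (g : F) (h : H)
    (f : H → H → M) : g (sw R h f) = sw R h (fun x y => g (f x y)) :=
  map_sum _ _ _

theorem tmul_sw (n : N) (h : H) (f : H → H → M) :
    n ⊗ₜ[R] sw R h f = sw R h (fun x y => n ⊗ₜ[R] f x y) :=
  TensorProduct.tmul_sum _ _ _

theorem sw_tmul (n : N) (h : H) (f : H → H → M) :
    sw R h f ⊗ₜ[R] n = sw R h (fun x y => f x y ⊗ₜ[R] n) :=
  TensorProduct.sum_tmul _ _ _

theorem smul_sw (r : R) (h : H) (f : H → H → M) :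
    r • sw R h f = sw R h (fun x y => r • f x y) :=
  Finset.smul_sum

theorem map_sw_apply (h : H) (f : H → H → (N →ₗ[R] M)) (n : N) :
    (sw R h f) n = sw R h (fun x y => f x y n) :=
  LinearMap.sum_apply _ _ _

end SweedlerSums

section SweedlerSumsMul

variable {R H B : Type*} [CommRing R] [AddCommGroup H] [Module R H] [Coalgebra R H] [Ring B]

theorem sw_mul (h : H) (f : H → H → B) (b : B) : sw R h f * b = sw R h (fun x y => f x y * b) :=
  Finset.sum_mul _ _ _

theorem mul_sw (h : H) (f : H → H → B) (b : B) : b * sw R h f = sw R h (fun x y => b * f x y) :=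
  Finset.mul_sum _ _ _

theorem conv_apply [Algebra R B] (f g : H →ₗ[R] B) (h : H) :
    conv f g h = sw R h fun x y => f x * g y :=
  (ℛ R h).convMul_apply (toConv f) (toConv g)

end SweedlerSumsMul

section SweedlerSumsBialgebra

variable {R H M : Type*} [CommRing R] [Ring H] [Bialgebra R H] [AddCommGroup M] [Module R M]

theorem sw_mul_arg {h k : H} {f : H → H → M} (h1 : ∀ y, Lin R (fun x => f x y))
    (h2 : ∀ x, Lin R (fun y => f x y)) :
    sw R (h * k) f = sw R h (fun x y => sw R k (fun z w => f (x * z) (y * w))) := by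
  rw [sw_eq_lift h1 h2, Bialgebra.comul_mul, comul_eq_sw h, comul_eq_sw k, sw_mul]
  simp [mul_sw, map_sw]

theorem sw_one_arg {f : H → H → M} (h1 : ∀ y, Lin R (fun x => f x y))
    (h2 : ∀ x, Lin R (fun y => f x y)) : sw R (1 : H) f = f 1 1 := by
  rw [sw_eq_lift h1 h2, Bialgebra.comul_one, Algebra.TensorProduct.one_def]
  simp

theorem leftHit_apply (f : Dual R H) (k : H) :
    leftHit f k = sw R k fun x y => f y • x := by
  simp [leftHit, comul_eq_sw k, map_sw]

theorem rightHit_apply (f : Dual R H) (k : H) :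
    rightHit f k = sw R k fun x y => f x • y := by
  simp [rightHit, comul_eq_sw k, map_sw]

end SweedlerSumsBialgebra

/-! ### Twisted antipodes -/

section TwistedAntipodes

variable {R H M : Type*} [CommRing R] [Ring H] [Bialgebra R H] [AddCommGroup M] [Module R M]
  {S : H →ₗ[R] H}

namespace IsTwistedAntipode

theorem sw_left (hS : IsTwistedAntipode S) (h : H) :
    sw R h (fun x y => S y * x) = counit (R := R) h • (1 : H) := by
  have := hS.left h
  rw [comul_eq_sw] at this
  simpa [map_sw, Algebra.algebraMap_eq_smul_one] using this

theorem sw_right (hS : IsTwistedAntipode S) (h : H) :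
    sw R h (fun x y => y * S x) = counit (R := R) h • (1 : H) := by
  have := hS.right h
  rw [comul_eq_sw] at this
  simpa [map_sw, Algebra.algebraMap_eq_smul_one] using this

/-- `∑ f(S(h₂) h₁, h₃) = f(1, h)`. -/
theorem cancel_left (hS : IsTwistedAntipode S) {h : H} {f : H → H → M}
    (h1 : ∀ y, Lin R (fun x => f x y)) (h2 : ∀ x, Lin R (fun y => f x y)) :
    sw R h (fun c d => sw R d (fun e w => f (S e * c) w)) = f 1 h := by
  rw [← sw_assoc (f := fun c e w => f (S e * c) w) (by fun_prop) (by fun_prop) (by fun_prop)]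
  have : ∀ x y : H, sw R x (fun u v => f (S v * u) y) = counit (R := R) x • f 1 y := fun x y => by
    rw [← (h1 y).smul, ← hS.sw_left x, ← (h1 y).toLinearMap_apply, map_sw]
    rfl
  simp only [this]
  exact sw_counit_left (h2 1)

/-- `∑ f(h₂ S(h₁), h₃) = f(1, h)`. -/
theorem cancel_right (hS : IsTwistedAntipode S) {h : H} {f : H → H → M}
    (h1 : ∀ y, Lin R (fun x => f x y)) (h2 : ∀ x, Lin R (fun y => f x y)) :
    sw R h (fun c d => sw R d (fun e w => f (e * S c) w)) = f 1 h := by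
  rw [← sw_assoc (f := fun c e w => f (e * S c) w) (by fun_prop) (by fun_prop) (by fun_prop)]
  have : ∀ x y : H, sw R x (fun u v => f (v * S u) y) = counit (R := R) x • f 1 y := fun x y => by
    rw [← (h1 y).smul, ← hS.sw_right x, ← (h1 y).toLinearMap_apply, map_sw]
    rfl
  simp only [this]
  exact sw_counit_left (h2 1)

theorem counit_apply (hS : IsTwistedAntipode S) (h : H) :
    counit (R := R) (S h) = counit (R := R) h := by
  have := congrArg (counit (R := R)) (hS.sw_left h)
  rw [map_sw] at this
  simp only [Bialgebra.counit_mul, map_smul, Bialgebra.counit_one, smul_eq_mul, mul_one] at this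
  rw [← this]
  have := sw_counit_left (R := R) (h := h) (f := fun x => counit (R := R) (S x)) (by fun_prop)
  simpa [mul_comm] using this.symm

/-- Uniqueness of inverses: in ∑ S(h₃k₃) h₂k₂ S(k₁)S(h₁), cancelling on the right leaves S(hk), and
cancelling on the left leaves S(k)S(h). -/
theorem map_mul (hS : IsTwistedAntipode S) (h k : H) : S (h * k) = S k * S h := by
  have key : sw R h (fun a b => sw R k (fun c d => sw R (b * d) (fun e g => S g * e) *
      (S c * S a))) = S (h * k) := by
    have e₁ (a e g : H) : sw R k (fun c d => sw R d fun e' g' =>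
        S (g * g') * (e * e') * (S c * S a)) = S (g * k) * e * S a := by
      simpa only [mul_assoc, one_mul] using hS.cancel_right (h := k)
        (f := fun x w => S (g * w) * (e * (x * S a))) (by fun_prop) (by fun_prop)
    have e₂ : sw R h (fun a b => sw R b fun e g => S (g * k) * e * S a) = S (h * k) := by
      simpa only [mul_assoc, mul_one] using hS.cancel_right (h := h)
        (f := fun x w => S (w * k) * x) (by fun_prop) (by fun_prop)
    simp (disch := fun_prop) only [sw_mul_arg, sw_mul, sw_comm (R := R) k, e₁, e₂]
  rw [← key]
  simp only [hS.sw_left, Bialgebra.counit_mul, mul_smul, smul_mul_assoc, one_mul]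
  simp (disch := fun_prop) only [sw_counit_right, ← smul_sw]

/-- S reverses the comultiplication. As for products, ∑ Δ(S h₃)Δ(h₂)(S ⊗ S)(h₁ flipped) is evaluated
in two ways. -/
theorem sw_map (hS : IsTwistedAntipode S) {h : H} {f : H → H → M}
    (h1 : ∀ y, Lin R (fun x => f x y)) (h2 : ∀ x, Lin R (fun y => f x y)) :
    sw R (S h) f = sw R h (fun x y => f (S y) (S x)) := by
  suffices e : comul (R := R) (S h) = sw R h fun x y => S y ⊗ₜ[R] S x by
    rw [sw_eq_lift h1 h2, e, map_sw]
    simp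
  have key : sw R h (fun a b => sw R b (fun e g => comul (R := R) (S g) * comul (R := R) e) *
      sw R a (fun x y => S y ⊗ₜ[R] S x)) = comul (R := R) (S h) := by
    have hD (g e : H) : comul (R := R) (S g) * comul (R := R) e =
        sw R e fun x y => comul (R := R) (S g) * (x ⊗ₜ[R] y) := by rw [comul_eq_sw e, mul_sw]
    have e₁ (t z : H) : sw R t (fun y b => sw R b fun x r => sw R r fun w g =>
        comul (R := R) (S g) * ((x * S y) ⊗ₜ[R] (w * S z))) =
        sw R t fun w g => comul (R := R) (S g) * (1 ⊗ₜ[R] (w * S z)) :=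
      hS.cancel_right (h := t) (f := fun u r => sw R r fun w g =>
        comul (R := R) (S g) * (u ⊗ₜ[R] (w * S z))) (by fun_prop) (by fun_prop)
    have e₂ := hS.cancel_right (h := h) (f := fun u g => comul (R := R) (S g) * (1 ⊗ₜ[R] u))
      (by fun_prop) (by fun_prop)
    simp only [mul_sw, hD]
    simp (disch := fun_prop) only [sw_mul, mul_assoc, sw_assoc,
      Algebra.TensorProduct.tmul_mul_tmul, e₁, e₂]
    exact mul_one _
  rw [← key]
  simp only [← Bialgebra.comul_mul, ← map_sw, hS.sw_left, map_smul, Bialgebra.comul_one,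
    smul_mul_assoc, one_mul]
  simp (disch := fun_prop) only [sw_counit_right]

end IsTwistedAntipode

end TwistedAntipodes

/-! ### Crossed products as rings with a normal basis -/

section NormalBasis

variable {R : Type u} {H : Type v} {A : Type w} [CommRing R] [Ring H] [Bialgebra R H] [Ring A]
  [Algebra R A]

@[fun_prop]
theorem lin_phi (S : H →ₗ[R] H) (act : H →ₗ[R] A →ₗ[R] A) (σ : H ⊗[R] H →ₗ[R] A) (a : A)
    (x : H) : Lin R fun h => phi S act σ h a x := by
  simp only [phi, sweedler_eq_sw, LinearMap.mk₂_apply]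
  fun_prop

theorem phi_apply (S : H →ₗ[R] H) (act : H →ₗ[R] A →ₗ[R] A) (σ : H ⊗[R] H →ₗ[R] A) (h : H) (a : A)
    (x : H) : phi S act σ h a x = sw R x fun x₁ x₂ => act (S x₂) a * σ (S x₁ ⊗ₜ h) := by
  simp only [phi, sweedler_eq_sw, LinearMap.mk₂_apply]

theorem psiHead_apply (S : H →ₗ[R] H) (σ' : H ⊗[R] H →ₗ[R] A) (x : H) :
    psiHead S σ' x = sw R x fun x₁ x₂ => σ' (x₂ ⊗ₜ S x₁) := by
  simp only [psiHead, sweedler_eq_sw, LinearMap.mk₂_apply]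

theorem psi_apply (S : H →ₗ[R] H) (act : H →ₗ[R] A →ₗ[R] A) (σ σ' : H ⊗[R] H →ₗ[R] A) (h : H)
    (a : A) (x : H) : psi S act σ σ' h a x = sw R x fun x₁ y => sw R y fun y₁ y₂ =>
      sw R y₁ fun u v => psiHead S σ' u * act v a * σ (y₂ ⊗ₜ (S x₁ * h)) := by
  simp only [psi, sweedler_eq_sw, LinearMap.mk₂_apply, conv_apply, sw_mul]
  rfl

@[fun_prop]
theorem lin_psi (S : H →ₗ[R] H) (act : H →ₗ[R] A →ₗ[R] A) (σ σ' : H ⊗[R] H →ₗ[R] A) (a : A)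
    (x : H) : Lin R fun h => psi S act σ σ' h a x := by
  simp only [psi_apply]
  fun_prop

/-- The data that make a ring `B` a crossed product `A #_σ H`: an algebra morphism `ι : A → B`, a
linear map `γ : H → B`, `a ⊗ h ↦ a # h = ι(a) γ(h)` being bijective, the coaction `ρ`, and the map
`a # h ↦ ε(h) a`. -/
structure NormalBasis (act : H →ₗ[R] A →ₗ[R] A) (σ : H ⊗[R] H →ₗ[R] A) (B : Type*) [Ring B]
    [Algebra R B] (ρ : B →ₗ[R] B ⊗[R] H) where
  ι : A →ₐ[R] B
  γ : H →ₗ[R] B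
  toA : B →ₗ[R] A
  equiv : A ⊗[R] H ≃ₗ[R] B
  equiv_tmul : ∀ a h, equiv (a ⊗ₜ h) = ι a * γ h
  toA_ι_γ : ∀ a h, toA (ι a * γ h) = counit (R := R) h • a
  γ_one : γ 1 = 1
  γ_ι : ∀ h a, γ h * ι a = sw R h fun x y => ι (act x a) * γ y
  γ_γ : ∀ h k, γ h * γ k = sw R h fun x y => sw R k fun z w => ι (σ (x ⊗ₜ z)) * γ (y * w)
  ρ_ι_γ : ∀ a h, ρ (ι a * γ h) = sw R h fun x y => (ι a * γ x) ⊗ₜ[R] y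

namespace NormalBasis

variable {act : H →ₗ[R] A →ₗ[R] A} {σ σ' : H ⊗[R] H →ₗ[R] A} {B : Type*} [Ring B] [Algebra R B]
  {ρ : B →ₗ[R] B ⊗[R] H} (D : NormalBasis act σ B ρ) {S : H →ₗ[R] H}

include D in
theorem ext {M : Type*} [AddCommGroup M] [Module R M] {f g : B →ₗ[R] M}
    (h : ∀ a k, f (D.ι a * D.γ k) = g (D.ι a * D.γ k)) : f = g := by
  have : f ∘ₗ D.equiv.toLinearMap = g ∘ₗ D.equiv.toLinearMap := by
    ext a k
    simpa [D.equiv_tmul] using h a k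
  ext b
  simpa using LinearMap.congr_fun this (D.equiv.symm b)

theorem toA_ι (a : A) : D.toA (D.ι a) = a := by
  simpa [D.γ_one] using D.toA_ι_γ a 1

theorem ρ_ι_mul (a : A) (b : B) : ρ (D.ι a * b) = (D.ι a ⊗ₜ 1) * ρ b := by
  have : ρ ∘ₗ LinearMap.mulLeft R (D.ι a) = LinearMap.mulLeft R (D.ι a ⊗ₜ[R] 1) ∘ₗ ρ := by
    refine D.ext fun c k => ?_
    simp only [LinearMap.comp_apply, LinearMap.mulLeft_apply, ← mul_assoc, ← map_mul, D.ρ_ι_γ,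
      mul_sw, Algebra.TensorProduct.tmul_mul_tmul, one_mul]
  exact LinearMap.congr_fun this b

theorem ρ_γ (h : H) : ρ (D.γ h) = sw R h fun x y => D.γ x ⊗ₜ[R] y := by
  simpa using D.ρ_ι_γ 1 h

theorem ρ_ι (a : A) : ρ (D.ι a) = D.ι a ⊗ₜ 1 := by
  have := D.ρ_ι_γ a 1
  rw [sw_one_arg (by fun_prop) (by fun_prop)] at this
  simpa [D.γ_one] using this

include D in
-- After factors from A are pulled out, only ρ(γ(h)ι(b)γ(k)) remains. There the commutation rules
-- for γ and multiplicativity of Δ suffice.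
theorem ρ_mul (b c : B) : ρ (b * c) = ρ b * ρ c := by
  have : (LinearMap.mul R B).compr₂ ρ = (LinearMap.mul R (B ⊗[R] H)).compl₁₂ ρ ρ := by
    refine D.ext fun a h => D.ext fun b k => ?_
    simp only [LinearMap.compr₂_apply, LinearMap.mul_apply', LinearMap.compl₁₂_apply, mul_assoc,
      D.ρ_ι_mul]
    congr 1
    simp only [← mul_assoc (D.γ _), D.γ_ι, D.ρ_γ, sw_mul, mul_sw,
      Algebra.TensorProduct.tmul_mul_tmul, one_mul, mul_assoc, D.γ_γ, map_sw, D.ρ_ι_mul, sw_tmul]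
    simp (disch := fun_prop) only [sw_mul_arg, sw_assoc]
    simp (disch := fun_prop) only [sw_comm (R := R) k, sw_assoc]
  exact LinearMap.congr_fun₂ this b c

include D in
theorem ρ_coassoc (b : B) :
    TensorProduct.assoc R B H H (ρ.rTensor H (ρ b)) = comul.lTensor B (ρ b) := by
  have : (TensorProduct.assoc R B H H).toLinearMap ∘ₗ ρ.rTensor H ∘ₗ ρ = comul.lTensor B ∘ₗ ρ := by
    refine D.ext fun a h => ?_
    simp only [LinearMap.comp_apply, D.ρ_ι_γ, map_sw, LinearMap.rTensor_tmul,
      LinearMap.lTensor_tmul, sw_tmul, LinearEquiv.coe_coe, TensorProduct.assoc_tmul, comul_eq_sw,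
      tmul_sw]
    simp (disch := fun_prop) only [sw_assoc]
  exact LinearMap.congr_fun this b

theorem ρ_mul_ι (b : B) (a : A) : ρ (b * D.ι a) = ρ b * (D.ι a ⊗ₜ 1) := by
  rw [D.ρ_mul, D.ρ_ι]

/-! #### The convolution inverse of `γ ∘ S` -/

/-- The map `δ(x) = ∑ σ'(x₂ ⊗ S x₁) γ(x₃)`, which satisfies
`∑ δ(x₂) γ(S x₁) = ε(x) 1 = ∑ γ(S x₂) δ(x₁)`. -/
def δ (S : H →ₗ[R] H) (σ' : H ⊗[R] H →ₗ[R] A) : H →ₗ[R] B :=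
  conv (D.ι.toLinearMap ∘ₗ psiHead S σ') D.γ

theorem δ_apply (x : H) : D.δ S σ' x = sw R x fun u v => D.ι (psiHead S σ' u) * D.γ v := by
  simp [δ, conv_apply]

/-- Colinearity of δ makes H* act on δ(k) through f ⇀ k. -/
theorem ρ_δ (x : H) : ρ (D.δ S σ' x) = sw R x fun u v => D.δ S σ' u ⊗ₜ[R] v := by
  simp only [δ_apply, map_sw, D.ρ_ι_γ, sw_tmul]
  simp (disch := fun_prop) only [sw_assoc]

/-- This is `γ_γ` solved for γ(hk): the relation σ⁻¹ ⋆ σ = ε removes the cocycle. -/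
theorem γ_mul_arg (hσ' : IsConvInverse σ σ') (h k : H) : D.γ (h * k) =
    sw R h fun x y => sw R k fun z w => D.ι (σ' (x ⊗ₜ z)) * (D.γ y * D.γ w) := by
  have key (h k : H) : sw R h (fun x y => sw R k fun z w => σ' (x ⊗ₜ z) * σ (y ⊗ₜ w)) =
      counit (R := R) h • counit (R := R) k • (1 : A) := by
    have := LinearMap.congr_fun (congrArg WithConv.ofConv hσ'.2) (h ⊗ₜ k)
    rw [sw_comm]
    simpa [LinearMap.convMul_def, TensorProduct.comul_tmul, comul_eq_sw h, comul_eq_sw k, sw_tmul,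
      tmul_sw, map_sw, LinearMap.convOne_def, Algebra.algebraMap_eq_smul_one, mul_smul,
      smul_comm (counit (R := R) h)] using this
  have e (x y : H) : sw R x (fun a b => sw R y fun c d =>
      D.ι (σ' (a ⊗ₜ[R] c) * σ (b ⊗ₜ[R] d))) = counit (R := R) x • counit (R := R) y • 1 := by
    simp only [← map_sw, key, map_smul, _root_.map_one]
  have : sw R h (fun x x' => sw R k fun y y' => sw R x (fun a b => sw R y fun c d =>
      D.ι (σ' (a ⊗ₜ[R] c) * σ (b ⊗ₜ[R] d))) * D.γ (x' * y')) = D.γ (h * k) := by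
    simp only [e, smul_mul_assoc, one_mul]
    simp (disch := fun_prop) only [← smul_sw, sw_counit_left]
  rw [← this]
  simp only [D.γ_γ, mul_sw, sw_mul, _root_.map_mul, mul_assoc]
  simp (disch := fun_prop) only [sw_comm (R := R) k, sw_assoc]

/-- Expand γ(x₂ S(x₁)) = ε(x)1 by `γ_mul_arg`; the formula for δ is read off from the result. -/
theorem δ_γS (hS : IsTwistedAntipode S) (hσ' : IsConvInverse σ σ') (x : H) :
    sw R x (fun u v => D.δ S σ' v * D.γ (S u)) = counit (R := R) x • 1 := by
  have e := congrArg D.γ (hS.sw_right x)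
  rw [map_smul, D.γ_one, map_sw] at e
  rw [← e]
  simp only [D.γ_mul_arg hσ', δ_apply, psiHead_apply, map_sw, sw_mul]
  simp (disch := fun_prop) only [hS.sw_map, sw_assoc, sw_assoc₂, mul_assoc]

/-- The H-parts multiply to S(k₂)k₁ and cancel, so the product falls into A. -/
theorem γS_γ (hS : IsTwistedAntipode S) (k : H) : sw R k (fun u v => D.γ (S v) * D.γ u) =
    sw R k fun u v => D.ι (σ (S v ⊗ₜ u)) := by
  have e (a b : H) : sw R b (fun c d => sw R d fun e w =>
      D.ι (σ (S w ⊗ₜ[R] a)) * D.γ (S e * c)) = D.ι (σ (S b ⊗ₜ[R] a)) := by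
    simpa only [D.γ_one, mul_one] using hS.cancel_left (h := b)
      (f := fun x w => D.ι (σ (S w ⊗ₜ[R] a)) * D.γ x) (by fun_prop) (by fun_prop)
  simp only [D.γ_γ]
  simp (disch := fun_prop) only [hS.sw_map]
  simp (disch := fun_prop) only [sw_assoc₂, e]

/-- The other half of invertibility. The product T lies in A and satisfies ∑ T(x₂)γ(S x₁) = γ(S x)
by `δ_γS`. Taking A-components, with ε ∘ S = ε, gives T = ε. -/
theorem γS_δ (hS : IsTwistedAntipode S) (hσ' : IsConvInverse σ σ') (x : H) :
    sw R x (fun u v => D.γ (S v) * D.δ S σ' u) = counit (R := R) x • 1 := by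
  set T : H → B := fun x => sw R x fun u v => D.γ (S v) * D.δ S σ' u with hT
  have hlin : Lin R T := by fun_prop
  have h1 (x : H) : D.ι (D.toA (T x)) = T x := by
    suffices ∃ a, T x = D.ι a by
      obtain ⟨a, ha⟩ := this
      rw [ha, D.toA_ι]
    have e (x y : H) : sw R y (fun u v => sw R v fun w z =>
        D.ι (act (S z) (psiHead S σ' x)) * D.γ (S w) * D.γ u) =
        D.ι (sw R y fun m z => act (S z) (psiHead S σ' x) * sw R m fun u v => σ (S v ⊗ₜ u)) := by
      rw [← sw_assoc (f := fun u w z => D.ι (act (S z) (psiHead S σ' x)) * D.γ (S w) * D.γ u)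
        (by fun_prop) (by fun_prop) (by fun_prop)]
      simp only [mul_assoc, ← mul_sw, D.γS_γ hS, ← map_sw, ← _root_.map_mul]
    simp only [hT, δ_apply, mul_sw, ← mul_assoc, D.γ_ι, sw_mul]
    simp (disch := fun_prop) only [hS.sw_map, sw_assoc, e, ← map_sw]
    exact ⟨_, rfl⟩
  have h2 (x : H) : sw R x (fun u v => D.ι (D.toA (T v)) * D.γ (S u)) = D.γ (S x) := by
    simp only [h1]
    simp only [hT, sw_mul, mul_assoc]
    rw [← sw_assoc (R := R) (f := fun u c d => D.γ (S d) * (D.δ S σ' c * D.γ (S u)))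
      (by fun_prop) (by fun_prop) (by fun_prop)]
    simp only [← mul_sw, D.δ_γS hS hσ', mul_smul_comm, mul_one]
    exact sw_counit_left (f := fun x => D.γ (S x)) (by fun_prop)
  have h3 := congrArg D.toA (h2 x)
  have h4 := D.toA_ι_γ 1 (S x)
  rw [_root_.map_one, one_mul] at h4
  simp only [map_sw, D.toA_ι_γ, hS.counit_apply, h4] at h3
  rw [sw_counit_left (f := fun v => D.toA (T v)) (by fun_prop)] at h3
  have h5 := h1 x
  rwa [h3, map_smul, _root_.map_one, eq_comm] at h5

/-! ### Commutation relations that produce φ and ψ -/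

/-- The relation `γ(S x) (a # h) = ∑ φ(h₁ ⊗ a)(x₂) # S(x₁) h₂`. -/
theorem γS_mul (hS : IsTwistedAntipode S) (x h : H) (a : A) : D.γ (S x) * (D.ι a * D.γ h) =
    sw R h fun h₁ h₂ => sw R x fun x₁ x₂ =>
      D.ι (phi S act σ h₁ a x₂) * D.γ (S x₁ * h₂) := by
  simp only [← mul_assoc, D.γ_ι, sw_mul, phi_apply, map_sw]
  simp (disch := fun_prop) only [hS.sw_map, mul_assoc, D.γ_γ, mul_sw, map_mul]
  simp (disch := fun_prop) only [sw_comm (R := R) h, sw_assoc]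

/-- The origin of ψ: it collects the A-coefficients when the left side is written in the form a' #
h'. -/
theorem δ_mul (hS : IsTwistedAntipode S) (x h : H) (a : A) :
    sw R x (fun x₁ x₂ => D.δ S σ' x₂ * D.ι a * D.γ (S x₁ * h)) =
    sw R h fun h₁ h₂ => sw R x fun x₁ x₂ => sw R x₂ fun y₁ y₂ =>
      D.ι (psi S act σ σ' h₁ a y₁) * D.γ (y₂ * (S x₁ * h₂)) := by
  simp only [δ_apply, psi_apply, sw_mul, mul_assoc, map_sw]
  have e (v x : H) : D.γ v * (D.ι a * D.γ (S x * h)) = sw R h fun p q => sw R x fun u w =>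
      sw R v fun c d => sw R d fun y z =>
      D.ι (act c a) * (D.ι (σ (y ⊗ₜ (S w * p))) * D.γ (z * (S u * q))) := by
    rw [← mul_assoc, D.γ_ι]
    simp (disch := fun_prop) only [sw_mul, mul_assoc, D.γ_γ, mul_sw, sw_mul_arg, hS.sw_map]
    simp only [sw_comm (R := R) v, sw_comm (R := R) x, sw_comm (R := R) (G := H) (k := h)]
  have e' (v x : H) : sw R v (fun b c => D.ι (psiHead S σ' b) * (D.γ c *
      (D.ι a * D.γ (S x * h)))) = sw R h fun p q => sw R x fun u w =>
      sw R v fun b c => sw R c fun c d => sw R d fun y z => D.ι (psiHead S σ' b) *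
      (D.ι (act c a) * (D.ι (σ (y ⊗ₜ (S w * p))) * D.γ (z * (S u * q)))) := by
    simp only [e, mul_sw, sw_comm (R := R) v]
  simp only [e']
  simp (disch := fun_prop) only [sw_comm (R := R) x, sw_assoc, map_mul, mul_assoc]

/-- Replacing `x` by `h₂ k` and `h` by `h₁` in a sum over `(x₂, S(x₁) h)`. -/
theorem _root_.HopfDuality.IsTwistedAntipode.sw_subst {M : Type*} [AddCommGroup M] [Module R M]
    (hS : IsTwistedAntipode S) {h k : H}
    {f : H → H → H → M} (h1 : ∀ y z, Lin R (fun x => f x y z))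
    (h2 : ∀ x z, Lin R (fun y => f x y z)) (h3 : ∀ x y, Lin R (fun z => f x y z)) :
    sw R h (fun g r => sw R g fun h₁ h₂ => sw R (r * k) fun x₁ x₂ => f h₁ x₂ (S x₁ * h₂)) =
      sw R h fun h₁ h₂ => sw R k fun k₁ k₂ => f h₁ (h₂ * k₂) (S k₁) := by
  simp (disch := fun_prop) only [sw_mul_arg, hS.map_mul, mul_assoc, sw_assoc]
  -- The last argument is S(h₃k₁)h₂ = S(k₁)S(h₃)h₂, where the factors from h cancel.
  have e (x y : H) := hS.cancel_left (h := y)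
    (f := fun t y => sw R k fun z w => f x (y * w) (S z * t)) (by fun_prop) (by fun_prop)
  simp only [e, mul_one]

/-- Multiplication by γ ∘ S can be undone by δ, so identities between functions into B may be
checked after it. -/
theorem sw_γS_δ (hS : IsTwistedAntipode S) (hσ' : IsConvInverse σ σ') {F : H → B} (hF : Lin R F)
    (k : H) : sw R k (fun u v => sw R v (fun c d => F d * D.γ (S c)) * D.δ S σ' u) = F k := by
  simp only [sw_mul, mul_assoc]
  rw [← sw_assoc (R := R) (f := fun u c d => F d * (D.γ (S c) * D.δ S σ' u))
    (by fun_prop) (by fun_prop) (by fun_prop)]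
  simp only [← mul_sw, D.γS_δ hS hσ', mul_smul_comm, mul_one]
  exact sw_counit_left (f := F) hF

/-- The relation `(a # h) δ(k) = ∑ δ(h₃ k₂) φ(h₁ ⊗ a)(h₂ k₁)`. -/
theorem mul_δ (hS : IsTwistedAntipode S) (hσ' : IsConvInverse σ σ') (a : A) (h k : H) :
    D.ι a * D.γ h * D.δ S σ' k = sw R h fun h₁ h₂ => sw R (h₂ * k) fun y₁ y₂ =>
      D.δ S σ' y₂ * D.ι (phi S act σ h₁ a y₁) := by
  -- F is the right-hand side as a function of k. By `e₂`, ∑ F(k₂)γ(S k₁) = ε(k)(a # h); `sw_γS_δ`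
  -- then recovers F.
  set F : H → B := fun k => sw R h fun h₁ h₂ => sw R (h₂ * k) fun y₁ y₂ =>
      D.δ S σ' y₂ * D.ι (phi S act σ h₁ a y₁) with hF
  have hlin : Lin R F := by fun_prop
  have e₁ (g x : H) : sw R g (fun h₁ h₂ => sw R x fun x₁ x₂ => sw R x₂ fun y₁ y₂ =>
      D.δ S σ' y₂ * (D.ι (phi S act σ h₁ a y₁) * D.γ (S x₁ * h₂))) =
      counit (R := R) x • (D.ι a * D.γ g) := by
    have := congrArg (· * (D.ι a * D.γ g)) (D.δ_γS hS hσ' x)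
    simp only [smul_mul_assoc, one_mul, sw_mul, mul_assoc, D.γS_mul hS, mul_sw] at this
    rw [← this]
    simp (disch := fun_prop) only [sw_comm (R := R) g, sw_assoc]
  have e₂ (k : H) : sw R k (fun c d => F d * D.γ (S c)) =
      counit (R := R) k • (D.ι a * D.γ h) := by
    have := hS.sw_subst (h := h) (k := k) (f := fun h₁ x z => sw R x fun y₁ y₂ =>
      D.δ S σ' y₂ * (D.ι (phi S act σ h₁ a y₁) * D.γ z)) (by fun_prop) (by fun_prop) (by fun_prop)
    simp only [e₁, Bialgebra.counit_mul, mul_smul, smul_comm _ (counit (R := R) k)] at this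
    rw [← smul_sw, sw_counit_right (f := fun g => D.ι a * D.γ g) (by fun_prop)] at this
    rw [this]
    simp only [hF, sw_mul, mul_assoc]
    rw [sw_comm (R := R) k]
  refine Eq.trans ?_ (D.sw_γS_δ hS hσ' hlin k)
  simp only [e₂, smul_mul_assoc]
  exact (sw_counit_right (f := fun u => D.ι a * D.γ h * D.δ S σ' u) (by fun_prop)).symm

theorem δ_mul_ι (hS : IsTwistedAntipode S) (hσ' : IsConvInverse σ σ') (a : A) (h k : H) :
    D.δ S σ' (h * k) * D.ι a = sw R h fun h₁ h₂ => sw R k fun u v => sw R v (fun k₁ k₂ =>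
      sw R (h₂ * k₂) fun y₁ y₂ =>
        D.ι (psi S act σ σ' h₁ a y₁) * D.γ (y₂ * S k₁)) * D.δ S σ' u := by
  have e₁ (k : H) := hS.sw_subst (h := h) (k := k) (f := fun h₁ x z => sw R x fun y₁ y₂ =>
    D.ι (psi S act σ σ' h₁ a y₁) * D.γ (y₂ * z)) (by fun_prop) (by fun_prop) (by fun_prop)
  simp only [← D.δ_mul hS] at e₁
  rw [← sw_comm (R := R) k]
  simp only [← sw_mul, ← e₁]
  -- The same substitution with ε(h₁) in place of ψ evaluates the left side of `e₁` as ∑ δ(hk₂) a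
  -- γ(S k₁).
  have e₂ (k : H) := hS.sw_subst (h := h) (k := k) (f := fun h₁ x z => counit (R := R) h₁ •
    (D.δ S σ' x * D.ι a * D.γ z)) (by fun_prop) (by fun_prop) (by fun_prop)
  have e₃ (g x : H) := sw_comm (R := R) g x (fun h₁ h₂ x₁ x₂ => counit (R := R) h₁ •
    (D.δ S σ' x₂ * D.ι a * D.γ (S x₁ * h₂)))
  have e₄ (x₁ x₂ g : H) := sw_counit_left (R := R) (h := g) (f := fun t =>
    D.δ S σ' x₂ * D.ι a * D.γ (S x₁ * t)) (by fun_prop)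
  have e₅ (k : H) := sw_counit_left (R := R) (h := h) (f := fun t => sw R k fun k₁ k₂ =>
    D.δ S σ' (t * k₂) * D.ι a * D.γ (S k₁)) (by fun_prop)
  simp only [e₃, e₄] at e₂
  simp only [← smul_sw, e₅] at e₂
  simp only [e₂]
  exact (D.sw_γS_δ hS hσ' (F := fun k => D.δ S σ' (h * k) * D.ι a) (by fun_prop) k).symm

/-- Here (g ⇀ v₂)S(v₁) sums to g(v)1. So an operator in λ(H ⊗ U), once carried over to B, becomes
the action of γ(h) # g on δ(k). -/
theorem sw_leftHit (hS : IsTwistedAntipode S) (h k : H)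
    (g : Dual R H) : sw R k (fun u v => sw R v (fun k₁ k₂ =>
      D.γ (h * leftHit g k₂ * S k₁)) * D.δ S σ' u) = D.γ h * D.δ S σ' (leftHit g k) := by
  have e (v : H) : sw R v (fun k₁ k₂ => D.γ (h * leftHit g k₂ * S k₁)) = g v • D.γ h := by
    have := hS.cancel_right (h := v) (f := fun t y => g y • D.γ (h * t))
      (by fun_prop) (by fun_prop)
    simpa only [leftHit_apply, mul_sw, sw_mul, map_sw, mul_smul_comm, smul_mul_assoc, map_smul,
      mul_assoc, mul_one] using this
  simp only [e, smul_mul_assoc]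
  simp only [leftHit_apply, map_sw, map_smul, mul_smul_comm, mul_sw]

end NormalBasis

end NormalBasis

/-! ### Tensor products with a power of the ring -/

section Purity

variable {R : Type*} [CommRing R]

theorem piScalarRightHom_rTensor {M N : Type*} [AddCommGroup M] [Module R M] [AddCommGroup N]
    [Module R N] (X : Type*) (f : M →ₗ[R] N) (t : M ⊗[R] (X → R)) (x : X) :
    TensorProduct.piScalarRightHom R R N X (f.rTensor (X → R) t) x =
      f (TensorProduct.piScalarRightHom R R M X t x) := by
  induction t with
  | zero => simp
  | tmul m p => simp
  | add s t hs ht => simp only [map_add, Pi.add_apply, hs, ht]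

theorem piScalarRightHom_free_surjective (n : ℕ) (X : Type*) :
    Function.Surjective (TensorProduct.piScalarRightHom R R (Fin n → R) X) := fun s =>
  ⟨∑ i, Pi.single i 1 ⊗ₜ fun x => s x i, by
    ext x j
    simp [Pi.single_apply]⟩

theorem piScalarRightHom_free_injective (n : ℕ) (X : Type*) :
    Function.Injective (TensorProduct.piScalarRightHom R R (Fin n → R) X) := by
  refine (injective_iff_map_eq_zero _).2 fun t ht => ?_
  obtain ⟨c, rfl⟩ := TensorProduct.eq_repr_basis_left (Pi.basisFun R (Fin n)) t
  have : c = 0 := by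
    ext i x
    have := congrFun (congrFun ht x) i
    simpa [Finsupp.sum_fintype, Pi.single_apply] using this
  simp [this]

/-- Compare with a finite presentation R^m → R^n → N, which exists over a Noetherian ring; for
finite free modules the map is bijective. -/
theorem piScalarRightHom_injective_of_finite [IsNoetherianRing R] (N : Type*) [AddCommGroup N]
    [Module R N] [Module.Finite R N] (X : Type*) :
    Function.Injective (TensorProduct.piScalarRightHom R R N X) := by
  refine (injective_iff_map_eq_zero _).2 fun t ht => ?_
  obtain ⟨n, f, hf⟩ := Module.Finite.exists_fin' R N
  obtain ⟨s, rfl⟩ := LinearMap.rTensor_surjective (X → R) hf t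
  obtain ⟨m, g, hg⟩ := Module.Finite.exists_fin' R (LinearMap.ker f)
  have hs (x : X) : ∃ l, g l =
      ⟨TensorProduct.piScalarRightHom R R (Fin n → R) X s x, by
        rw [LinearMap.mem_ker, ← piScalarRightHom_rTensor, ht, Pi.zero_apply]⟩ := hg _
  -- Relations may be chosen independently at each point, because every function X → R^m comes from
  -- R^m ⊗ R^X.
  choose l hl using hs
  obtain ⟨u, hu⟩ := piScalarRightHom_free_surjective m X l
  have : s = ((LinearMap.ker f).subtype ∘ₗ g).rTensor (X → R) u := by
    apply piScalarRightHom_free_injective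
    ext1 x
    rw [piScalarRightHom_rTensor, hu, LinearMap.comp_apply, hl]
    rfl
  rw [this, ← LinearMap.comp_apply, ← LinearMap.rTensor_comp, ← LinearMap.comp_assoc,
    LinearMap.comp_ker_subtype]
  simp

/-- Over a Noetherian ring, `N ⊗ R^X → N^X` is injective. -/
theorem piScalarRightHom_injective [IsNoetherianRing R] (N : Type*) [AddCommGroup N]
    [Module R N] (X : Type*) :
    Function.Injective (TensorProduct.piScalarRightHom R R N X) := by
  refine (injective_iff_map_eq_zero _).2 fun t ht => ?_
  -- A tensor involves only finitely many elements of N, so it comes from a finitely generated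
  -- submodule P.
  obtain ⟨P, hP, s, rfl⟩ := Submodule.exists_fg_le_eq_rTensor_subtype t
  have : Module.Finite R P := Module.Finite.iff_fg.2 hP
  rw [piScalarRightHom_injective_of_finite P X (a₁ := s) (a₂ := 0), map_zero]
  ext1 x
  apply P.subtype_injective
  rw [← piScalarRightHom_rTensor, ht]
  simp

end Purity

/-! ### Evaluation of tensors in N ⊗ U -/

section Evaluation

variable {R : Type u} {H : Type v} [CommRing R] [Ring H] [Bialgebra R H]

/-- The map `N ⊗ U → N^H`, `n ⊗ f ↦ [h ↦ f(h) n]`. -/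
def evalTensor (U : RightModuleSubalgebra R H) (N : Type*) [AddCommGroup N] [Module R N] :
    N ⊗[R] U.toNonUnitalSubalgebra →ₗ[R] (H → N) :=
  TensorProduct.piScalarRightHom R R N H ∘ₗ
    (LinearMap.ltoFun R H R R ∘ₗ (WithConv.linearEquiv R (H →ₗ[R] R)).toLinearMap ∘ₗ
      U.sub.subtype).lTensor N

theorem evalTensor_tmul (U : RightModuleSubalgebra R H) {N : Type*} [AddCommGroup N] [Module R N]
    (n : N) (f : U.toNonUnitalSubalgebra) (h : H) :
    evalTensor U N (n ⊗ₜ f) h = (f : Dual R H) h • n := rfl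

/-- A submodule of `H*` is isomorphic to its image in `R^H`. -/
def equivInFunctions (U : Submodule R (Dual R H)) : U ≃ₗ[R] inFunctions U :=
  Submodule.equivMapOfInjective _
    (fun _ _ h => WithConv.ofConv_injective (DFunLike.coe_injective h)) U

theorem IsPureFor.congr {M : Type*} [AddCommGroup M] [Module R M] {K : Submodule R M}
    {N N' : Type*} [AddCommGroup N] [Module R N] [AddCommGroup N'] [Module R N'] (e : N ≃ₗ[R] N')
    (h : IsPureFor K N) : IsPureFor K N' := by
  have : K.subtype.rTensor N' = e.toLinearMap.lTensor M ∘ₗ K.subtype.rTensor N ∘ₗ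
      e.symm.toLinearMap.lTensor K := by
    ext; simp
  rw [IsPureFor, this]
  exact (e.lTensor M).injective.comp (h.comp (e.symm.lTensor K).injective)

theorem evalTensor_injective [IsNoetherianRing R] {U : RightModuleSubalgebra R H} {N : Type*}
    [AddCommGroup N] [Module R N] (h : IsPureFor (inFunctions U.sub) N) :
    Function.Injective (evalTensor U N) := by
  refine (piScalarRightHom_injective N H).comp ?_
  have : (LinearMap.ltoFun R H R R ∘ₗ (WithConv.linearEquiv R (H →ₗ[R] R)).toLinearMap ∘ₗ
      U.sub.subtype).lTensor N = (TensorProduct.comm R (H → R) N).toLinearMap ∘ₗ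
      (inFunctions U.sub).subtype.rTensor N ∘ₗ (TensorProduct.comm R N _).toLinearMap ∘ₗ
      (equivInFunctions U.sub).toLinearMap.lTensor N := by
    ext; rfl
  rw [this]
  exact (TensorProduct.comm R (H → R) N).injective.comp (h.comp
    ((TensorProduct.comm R N _).injective.comp ((equivInFunctions U.sub).lTensor N).injective))

end Evaluation

/-! ### Pure submodules of the finite dual -/

section FiniteDualPurity

variable {R : Type u} {H : Type v} [CommRing R] [IsNoetherianRing R] [Ring H] [Bialgebra R H]

theorem isPureFor_of_isSubbialgebraOfFiniteDual (hH : IsAlphaAlgebra.{u, v, max u v w} R H)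
    {U : RightModuleSubalgebra R H} (hU : IsSubbialgebraOfFiniteDual.{u, v, max u v w} U)
    (N : Type (max u v w)) [AddCommGroup N] [Module R N] : IsPureFor (inFunctions U.sub) N := by
  have h₁ := hH N
  have h₂ := hU.pure N
  let e : U.sub.submoduleOf (finiteDual R H) ≃ₗ[R] inFunctions U.sub :=
    (Submodule.submoduleOfEquivOfLe hU.le).trans (equivInFunctions U.sub)
  have : (inFunctions U.sub).subtype.rTensor N =
      (inFunctions (finiteDual R H)).subtype.rTensor N ∘ₗ
        (equivInFunctions (finiteDual R H)).toLinearMap.rTensor N ∘ₗ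
        (U.sub.submoduleOf (finiteDual R H)).subtype.rTensor N ∘ₗ
        e.symm.toLinearMap.rTensor N := by
    simp only [← LinearMap.rTensor_comp]
    congr 1
    ext x
    obtain ⟨x, rfl⟩ := e.surjective x
    simp
    rfl
  rw [IsPureFor, this]
  exact h₁.comp (((equivInFunctions (finiteDual R H)).rTensor N).injective.comp
    (h₂.comp (e.symm.rTensor N).injective))

end FiniteDualPurity

/-! ### The action of a smash product -/

section SmashAction

variable {R : Type u} {H : Type v} [CommRing R] [Ring H] [Bialgebra R H]
  {B : Type w} [Ring B] [Algebra R B]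

/-- The map `v ↦ ∑ f(v₁) v₀`. -/
def dualHit (ρ : B →ₗ[R] B ⊗[R] H) (f : Dual R H) : B →ₗ[R] B :=
  (TensorProduct.rid R B).toLinearMap ∘ₗ f.ofConv.lTensor B ∘ₗ ρ

/-- The action `(b # f) v = ∑ b v₀ f(v₁)` of `B # U` on `B`. -/
def smashAct (ρ : B →ₗ[R] B ⊗[R] H) (U : RightModuleSubalgebra R H) :
    SmashProduct ρ U →ₗ[R] (B →ₗ[R] B) :=
  (TensorProduct.lift <| LinearMap.mk₂ R
    (fun b f => LinearMap.mulLeft R b ∘ₗ dualHit ρ (f : Dual R H))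
    (fun b c f => by ext; simp [add_mul]) (fun r b f => by ext; simp)
    (fun b f g => by ext; simp [dualHit, LinearMap.lTensor_add, mul_add])
    (fun r b f => by ext; simp [dualHit, LinearMap.lTensor_smul]) :
    B ⊗[R] U.toNonUnitalSubalgebra →ₗ[R] (B →ₗ[R] B))

variable {ρ : B →ₗ[R] B ⊗[R] H} {U : RightModuleSubalgebra R H}

theorem smashAct_mk (b : B) (f : U.toNonUnitalSubalgebra) (v : B) :
    smashAct ρ U (SmashProduct.mk ρ U b f) v = b * dualHit ρ (f : Dual R H) v := rfl

theorem SmashProduct.induction {P : SmashProduct ρ U → Prop} (zero : P 0)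
    (mk : ∀ b f, P (SmashProduct.mk ρ U b f)) (add : ∀ x y, P x → P y → P (x + y))
    (x : SmashProduct ρ U) : P x :=
  TensorProduct.induction_on (motive := P) x zero mk add

theorem dualHit_comul (f : Dual R H) : dualHit comul f = leftHit f := rfl

theorem dualHit_one (h : ∀ v, counit.lTensor B (ρ v) = v ⊗ₜ[R] 1) (v : B) :
    dualHit ρ 1 v = v := by
  have : dualHit ρ 1 v = TensorProduct.rid R B (counit.lTensor B (ρ v)) := rfl
  rw [this, h]
  simp

theorem ρ_dualHit (hco : ∀ b, TensorProduct.assoc R B H H (ρ.rTensor H (ρ b)) =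
    comul.lTensor B (ρ b)) (g : Dual R H) (v : B) :
    ρ (dualHit ρ g v) = (leftHit g).lTensor B (ρ v) := by
  have e₁ (t : B ⊗[R] H) : ρ (TensorProduct.rid R B (g.ofConv.lTensor B t)) =
      TensorProduct.rid R (B ⊗[R] H) (g.ofConv.lTensor (B ⊗[R] H) (ρ.rTensor H t)) := by
    induction t with
    | zero => simp
    | tmul b h => simp
    | add s t hs ht => simp only [map_add, hs, ht]
  have e₂ (t : B ⊗[R] H) : TensorProduct.rid R (B ⊗[R] H) (g.ofConv.lTensor (B ⊗[R] H)
      ((TensorProduct.assoc R B H H).symm (comul.lTensor B t))) = (leftHit g).lTensor B t := by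
    induction t with
    | zero => simp
    | tmul b h => simp [comul_eq_sw h, tmul_sw, map_sw, leftHit_apply]
    | add s t hs ht => simp only [map_add, hs, ht]
  change ρ (TensorProduct.rid R B (g.ofConv.lTensor B (ρ v))) = _
  rw [e₁, ← e₂, ← hco, LinearEquiv.symm_apply_apply]

theorem dual_mul_apply (f g : Dual R H) (h : H) : (f * g) h = sw R h fun x y => f x * g y :=
  (ℛ R h).convMul_apply f g

theorem dualHit_mul (hco : ∀ b, TensorProduct.assoc R B H H (ρ.rTensor H (ρ b)) =
    comul.lTensor B (ρ b)) (f g : Dual R H) (v : B) :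
    dualHit ρ f (dualHit ρ g v) = dualHit ρ (f * g) v := by
  change TensorProduct.rid R B (f.ofConv.lTensor B (ρ (dualHit ρ g v))) =
    TensorProduct.rid R B ((f * g).ofConv.lTensor B (ρ v))
  rw [ρ_dualHit hco]
  generalize ρ v = t
  induction t with
  | zero => simp
  | tmul b h =>
    simp only [LinearMap.lTensor_tmul, TensorProduct.rid_tmul, dual_mul_apply, leftHit_apply,
      map_sw, map_smul, smul_eq_mul, mul_comm]
  | add s t hs ht => simp only [map_add, hs, ht]

/-- H* acts on products in B through the multiplicative coaction. This is the computation behind the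
smash product rule. -/
theorem dualHit_mul_left (hmul : ∀ b c, ρ (b * c) = ρ b * ρ c)
    (hco : ∀ b, TensorProduct.assoc R B H H (ρ.rTensor H (ρ b)) = comul.lTensor B (ρ b))
    (f g : Dual R H) {ι : Type*} {b : B} (s : Finset ι) (l : ι → B) (r : ι → H)
    (h : ρ b = ∑ i ∈ s, l i ⊗ₜ[R] r i) (v : B) :
    dualHit ρ f (b * dualHit ρ g v) = ∑ i ∈ s, l i * dualHit ρ (dualAct R H f (r i) * g) v := by
  change TensorProduct.rid R B (f.ofConv.lTensor B (ρ (b * dualHit ρ g v))) = ∑ i ∈ s, l i *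
    TensorProduct.rid R B ((dualAct R H f (r i) * g).ofConv.lTensor B (ρ v))
  rw [hmul, ρ_dualHit hco, h, Finset.sum_mul, map_sum, map_sum]
  refine Finset.sum_congr rfl fun i _ => ?_
  generalize ρ v = t
  induction t with
  | zero => simp
  | tmul c y =>
    simp only [LinearMap.lTensor_tmul, TensorProduct.rid_tmul, dual_mul_apply, leftHit_apply,
      Algebra.TensorProduct.tmul_mul_tmul, mul_sw, map_sw, mul_smul_comm, map_smul, smul_eq_mul,
      mul_comm (g _)]
    rfl
  | add s t hs ht => simp only [map_add, mul_add, hs, ht]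

theorem smashAct_mul (hmul : ∀ b c, ρ (b * c) = ρ b * ρ c)
    (hco : ∀ b, TensorProduct.assoc R B H H (ρ.rTensor H (ρ b)) = comul.lTensor B (ρ b))
    (x y : SmashProduct ρ U) : smashAct ρ U (x * y) = smashAct ρ U x ∘ₗ smashAct ρ U y := by
  induction x using SmashProduct.induction with
  | zero => simp
  | add x x' hx hx' => rw [add_mul, map_add, map_add, hx, hx', LinearMap.add_comp]
  | mk b f =>
  induction y using SmashProduct.induction with
  | zero => simp
  | add y y' hy hy' => rw [mul_add, map_add, map_add, hy, hy', LinearMap.comp_add]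
  | mk b' g =>
  obtain ⟨s, hs⟩ := TensorProduct.exists_finset (ρ b')
  have e : SmashProduct.mk ρ U b f * SmashProduct.mk ρ U b' g =
      ∑ i ∈ s, SmashProduct.mk ρ U (b * i.1) (U.act f i.2 * g) :=
    smashMul_tmul ρ U b b' f g s _ _ hs
  ext v
  rw [e, map_sum, LinearMap.sum_apply, LinearMap.comp_apply, smashAct_mk, smashAct_mk,
    dualHit_mul_left hmul hco _ _ s _ _ hs, Finset.mul_sum]
  refine Finset.sum_congr rfl fun i _ => ?_
  rw [smashAct_mk, mul_assoc]
  rfl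

theorem smashAct_comul_mul (x y : HopfSmash U) :
    smashAct comul U (x * y) = smashAct comul U x ∘ₗ smashAct comul U y :=
  smashAct_mul (fun _ _ => Bialgebra.comul_mul _ _) coassoc_apply x y

end SmashAction

/-! ### The action of A ⊗ (H # U) -/

section TensorAction

variable {R : Type u} {H : Type v} {A : Type w} [CommRing R] [Ring H] [Bialgebra R H] [Ring A]
  [Algebra R A] {U : RightModuleSubalgebra R H}

/-- The action of `A ⊗ (H # U)` on `A ⊗ H`. -/
def tensorAct (A : Type w) [Ring A] [Algebra R A] (U : RightModuleSubalgebra R H) :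
    A ⊗[R] HopfSmash U →ₗ[R] (A ⊗[R] H →ₗ[R] A ⊗[R] H) :=
  TensorProduct.homTensorHomMap (.id R) A H A H ∘ₗ
    TensorProduct.map (LinearMap.mul R A) (smashAct comul U)

theorem tensorAct_tmul (a c : A) (z : HopfSmash U) (k : H) :
    tensorAct A U (a ⊗ₜ z) (c ⊗ₜ k) = (a * c) ⊗ₜ smashAct comul U z k := rfl

theorem tensorAct_mul (x y : A ⊗[R] HopfSmash U) :
    tensorAct A U (x * y) = tensorAct A U x ∘ₗ tensorAct A U y := by
  induction x with
  | zero => simp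
  | add x x' hx hx' => rw [add_mul, map_add, map_add, hx, hx', LinearMap.add_comp]
  | tmul a z =>
  induction y with
  | zero => simp
  | add y y' hy hy' => rw [mul_add, map_add, map_add, hy, hy', LinearMap.comp_add]
  | tmul b z' =>
  ext c k
  simp [Algebra.TensorProduct.tmul_mul_tmul, tensorAct_tmul, smashAct_comul_mul, mul_assoc]

theorem tensorAct_mulRight (y : A ⊗[R] HopfSmash U) (c : A) (k : H) :
    tensorAct A U y (c ⊗ₜ k) =
      (LinearMap.mulRight R c).rTensor H (tensorAct A U y (1 ⊗ₜ k)) := by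
  induction y with
  | zero => simp
  | add x y hx hy => simp only [map_add, LinearMap.add_apply, hx, hy]
  | tmul a z => simp [tensorAct_tmul]

/-- Since ∑ h(f ⇀ k₂)S(k₁) = f(k)h, the action determines the evaluation of y, and purity determines
y. -/
theorem tensorAct_injective [IsNoetherianRing R] {S : H →ₗ[R] H} (hS : IsTwistedAntipode S)
    (hU : IsPureFor (inFunctions U.sub) (A ⊗[R] H)) {y : A ⊗[R] HopfSmash U}
    (hy : ∀ k, tensorAct A U y (1 ⊗ₜ k) = 0) : y = 0 := by
  let e : A ⊗[R] HopfSmash U ≃ₗ[R] (A ⊗[R] H) ⊗[R] U.toNonUnitalSubalgebra :=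
    (TensorProduct.assoc R A H U.toNonUnitalSubalgebra).symm
  have key (y : A ⊗[R] HopfSmash U) (k : H) : evalTensor U (A ⊗[R] H) (e y) k =
      sw R k fun u v => (LinearMap.mulRight R (S u)).lTensor A (tensorAct A U y (1 ⊗ₜ v)) := by
    induction y with
    | zero => simp [sw_zero]
    | add x y hx hy => simp only [map_add, LinearMap.add_apply, Pi.add_apply, hx, hy, sw_add]
    | tmul a z =>
      induction z using SmashProduct.induction with
      | zero => simp [sw_zero]
      | add x y hx hy =>
        simp only [TensorProduct.tmul_add, map_add, LinearMap.add_apply, Pi.add_apply, hx, hy,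
          sw_add]
      | mk h f =>
        have : e (a ⊗ₜ SmashProduct.mk comul U h f) = (a ⊗ₜ h) ⊗ₜ f := rfl
        rw [this, evalTensor_tmul]
        have := hS.cancel_right (h := k) (f := fun x y => (f : Dual R H) y • (a ⊗ₜ[R] (h * x)))
          (by fun_prop) (by fun_prop)
        rw [mul_one] at this
        simp only [← this, tensorAct_tmul, mul_one, smashAct_mk, dualHit_comul, leftHit_apply,
          mul_sw, tmul_sw, mul_smul_comm, TensorProduct.tmul_smul]
        simp only [map_sw, map_smul, LinearMap.lTensor_tmul, LinearMap.mulRight_apply, mul_assoc]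
  apply e.injective
  apply evalTensor_injective hU
  ext1 k
  simp [key, hy, sw_zero]

end TensorAction

/-! ### The duality isomorphism -/

section RL

variable {R : Type u} {H : Type v} [CommRing R] [Ring H] [Bialgebra R H]
  {U : RightModuleSubalgebra R H}

theorem leftHit_mul_arg (g : Dual R H) (h k : H) :
    leftHit g (h * k) = sw R h fun x y => x * leftHit (dualAct R H g y) k := by
  simp (disch := fun_prop) only [leftHit_apply, sw_mul_arg]
  simp only [mul_sw, mul_smul_comm]
  rfl

/-- The image of H # U is stable under precomposition with left multiplication by h, because U is
stable under the H-action. -/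
theorem exists_smashAct_mul_arg (z : HopfSmash U) (h : H) :
    ∃ z' : HopfSmash U, ∀ k, smashAct comul U z (h * k) = smashAct comul U z' k := by
  induction z using SmashProduct.induction with
  | zero => exact ⟨0, by simp⟩
  | add x y hx hy =>
    obtain ⟨x', hx⟩ := hx
    obtain ⟨y', hy⟩ := hy
    exact ⟨x' + y', fun k => by simp [hx, hy]⟩
  | mk b g =>
    refine ⟨sw R h fun x y => SmashProduct.mk comul U (b * x) (U.act g y), fun k => ?_⟩
    simp only [map_sw, map_sw_apply, smashAct_mk, dualHit_comul, leftHit_mul_arg, mul_sw,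
      mul_assoc]
    rfl

theorem exists_smashAct_leftHit (z : HopfSmash U) (f : U.toNonUnitalSubalgebra) :
    ∃ z' : HopfSmash U, ∀ k,
      smashAct comul U z (leftHit (f : Dual R H) k) = smashAct comul U z' k := by
  induction z using SmashProduct.induction with
  | zero => exact ⟨0, by simp⟩
  | add x y hx hy =>
    obtain ⟨x', hx⟩ := hx
    obtain ⟨y', hy⟩ := hy
    exact ⟨x' + y', fun k => by simp [hx, hy]⟩
  | mk b g =>
    refine ⟨SmashProduct.mk comul U b (g * f), fun k => ?_⟩
    rw [smashAct_mk, smashAct_mk]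
    congr 1
    exact dualHit_mul coassoc_apply _ _ _

end RL

theorem exists_linearEquiv_of_range_eq {R X Y Z : Type*} [CommRing R] [AddCommGroup X]
    [Module R X] [AddCommGroup Y] [Module R Y] [AddCommGroup Z] [Module R Z] {f : X →ₗ[R] Z}
    {g : Y →ₗ[R] Z} (hf : Function.Injective f) (hg : Function.Injective g)
    (hfg : ∀ x, ∃ y, g y = f x) (hgf : ∀ y, ∃ x, f x = g y) :
    ∃ e : X ≃ₗ[R] Y, ∀ x, g (e x) = f x := by
  have h : LinearMap.range f = LinearMap.range g := le_antisymm
    (by rintro _ ⟨x, rfl⟩; exact hfg x) (by rintro _ ⟨y, rfl⟩; exact hgf y)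
  refine ⟨(LinearEquiv.ofInjective f hf).trans ((LinearEquiv.ofEq _ _ h).trans
    (LinearEquiv.ofInjective g hg).symm), fun x => ?_⟩
  simp

/-! ### Comparison of the two actions -/

namespace NormalBasis

variable {R : Type u} {H : Type v} {A : Type w} [CommRing R] [Ring H] [Bialgebra R H] [Ring A]
  [Algebra R A] {act : H →ₗ[R] A →ₗ[R] A} {σ σ' : H ⊗[R] H →ₗ[R] A} {B : Type x} [Ring B]
  [Algebra R B] {ρ : B →ₗ[R] B ⊗[R] H} (D : NormalBasis act σ B ρ) {S : H →ₗ[R] H}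
  {U : RightModuleSubalgebra R H} {V : Submodule R (Dual R H)}

/-- The map `A ⊗ H → B`, `a ⊗ k ↦ δ(k) a`. -/
def rightEquiv (S : H →ₗ[R] H) (σ' : H ⊗[R] H →ₗ[R] A) : A ⊗[R] H →ₗ[R] B :=
  TensorProduct.lift ((LinearMap.mul R B).flip.compl₁₂ D.ι.toLinearMap (D.δ S σ'))

theorem rightEquiv_tmul (a : A) (k : H) : D.rightEquiv S σ' (a ⊗ₜ k) = D.δ S σ' k * D.ι a := rfl

theorem rightEquiv_mulRight (t : A ⊗[R] H) (c : A) :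
    D.rightEquiv S σ' ((LinearMap.mulRight R c).rTensor H t) = D.rightEquiv S σ' t * D.ι c := by
  induction t with
  | zero => simp
  | tmul a k => simp [rightEquiv_tmul, mul_assoc]
  | add s t hs ht => simp only [map_add, add_mul, hs, ht]

theorem rightEquiv_injective (hS : IsTwistedAntipode S) (hσ' : IsConvInverse σ σ') :
    Function.Injective (D.rightEquiv S σ') := by
  -- M ∘ ρ is a left inverse: colinearity of δ gives ∑ γ(S k₂)δ(k₁)a ⊗ k₃ = a ⊗ k.
  let M : B ⊗[R] H →ₗ[R] A ⊗[R] H := TensorProduct.lift (LinearMap.mk₂ R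
    (fun b y => sw R y fun y₁ y₂ => D.toA (D.γ (S y₁) * b) ⊗ₜ[R] y₂)
    (fun b c y => Lin.add (R := R) (f := fun b => sw R y fun y₁ y₂ =>
      D.toA (D.γ (S y₁) * b) ⊗ₜ[R] y₂) (by fun_prop) b c)
    (fun r b y => Lin.smul (R := R) (f := fun b => sw R y fun y₁ y₂ =>
      D.toA (D.γ (S y₁) * b) ⊗ₜ[R] y₂) (by fun_prop) r b)
    (fun b => Lin.add (R := R) (f := fun y => sw R y fun y₁ y₂ =>
      D.toA (D.γ (S y₁) * b) ⊗ₜ[R] y₂) (by fun_prop))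
    (fun r b => Lin.smul (R := R) (f := fun y => sw R y fun y₁ y₂ =>
      D.toA (D.γ (S y₁) * b) ⊗ₜ[R] y₂) (by fun_prop) r))
  have hM (b : B) (y : H) : M (b ⊗ₜ y) = sw R y fun y₁ y₂ => D.toA (D.γ (S y₁) * b) ⊗ₜ[R] y₂ := rfl
  suffices h : M ∘ₗ ρ ∘ₗ D.rightEquiv S σ' = LinearMap.id from
    Function.LeftInverse.injective (g := M ∘ ρ) (LinearMap.congr_fun h)
  ext a k
  have e (x y : H) : sw R x (fun u v => D.toA (D.γ (S v) * (D.δ S σ' u * D.ι a)) ⊗ₜ[R] y) =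
      counit (R := R) x • (a ⊗ₜ[R] y) := by
    simp only [← mul_assoc, ← sw_mul, ← sw_tmul, ← map_sw, D.γS_δ hS hσ', smul_mul_assoc, one_mul,
      map_smul, toA_ι, TensorProduct.smul_tmul']
  simp only [TensorProduct.AlgebraTensorModule.curry_apply, TensorProduct.curry_apply,
    LinearMap.coe_restrictScalars, LinearMap.comp_apply, rightEquiv_tmul, ρ_mul_ι, ρ_δ, sw_mul,
    Algebra.TensorProduct.tmul_mul_tmul, mul_one, map_sw, hM, LinearMap.id_apply]
  rw [← sw_assoc (R := R) (f := fun u v y => D.toA (D.γ (S v) * (D.δ S σ' u * D.ι a)) ⊗ₜ[R] y)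
    (by fun_prop) (by fun_prop) (by fun_prop)]
  simp only [e]
  exact sw_counit_left (f := fun k => a ⊗ₜ[R] k) (by fun_prop)

theorem dualHit_δ (f : Dual R H) (k : H) :
    dualHit ρ f (D.δ S σ' k) = D.δ S σ' (leftHit f k) := by
  simp [dualHit, ρ_δ, leftHit_apply, map_sw]

theorem dualHit_mul_ι (f : Dual R H) (b : B) (c : A) :
    dualHit ρ f (b * D.ι c) = dualHit ρ f b * D.ι c := by
  simp only [dualHit, LinearMap.comp_apply, ρ_mul_ι]
  generalize ρ b = t
  induction t with
  | zero => simp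
  | tmul a k => simp
  | add s t hs ht => simp only [map_add, add_mul, hs, ht]

theorem smashAct_δ (b : B) (f : U.toNonUnitalSubalgebra) (k : H) :
    smashAct ρ U (SmashProduct.mk ρ U b f) (D.δ S σ' k) =
      b * D.δ S σ' (leftHit (f : Dual R H) k) := by
  rw [smashAct_mk, dualHit_δ]

include D in
theorem smashAct_mul_ι (x : SmashProduct ρ U) (b : B) (c : A) :
    smashAct ρ U x (b * D.ι c) = smashAct ρ U x b * D.ι c := by
  induction x using SmashProduct.induction with
  | zero => simp
  | mk b' f => rw [smashAct_mk, smashAct_mk, D.dualHit_mul_ι, mul_assoc]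
  | add x y hx hy => simp only [map_add, LinearMap.add_apply, hx, hy, add_mul]

/-- Since ∑ δ(f ⇀ k₂)γ(S k₁) = f(k)1, the action determines the evaluation of x. -/
theorem smashAct_injective [IsNoetherianRing R] (hS : IsTwistedAntipode S)
    (hσ' : IsConvInverse σ σ') (hU : IsPureFor (inFunctions U.sub) (A ⊗[R] H))
    {x : SmashProduct ρ U} (hx : ∀ k, smashAct ρ U x (D.δ S σ' k) = 0) : x = 0 := by
  have key (x : SmashProduct ρ U) (k : H) : evalTensor U B x k =
      sw R k fun u v => smashAct ρ U x (D.δ S σ' v) * D.γ (S u) := by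
    induction x using SmashProduct.induction with
    | zero =>
      simp only [map_zero, LinearMap.zero_apply, zero_mul, sw_zero]
      exact congrFun (map_zero (evalTensor U B)) k
    | add x y hx hy =>
      simp only [map_add, LinearMap.add_apply, add_mul, sw_add, ← hx, ← hy]
      exact congrFun (map_add (evalTensor U B) x y) k
    | mk b f =>
      simp only [smashAct_δ, leftHit_apply, map_sw, mul_sw, sw_mul, map_smul, mul_smul_comm,
        smul_mul_assoc, mul_assoc]
      rw [← sw_assoc (R := R) (f := fun u v y => (f : Dual R H) y • (b * (D.δ S σ' v * D.γ (S u))))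
        (by fun_prop) (by fun_prop) (by fun_prop)]
      simp only [← smul_sw, ← mul_sw, D.δ_γS hS hσ', mul_smul_comm, mul_one,
        smul_comm _ (counit (R := R) _)]
      exact (sw_counit_left (f := fun k => (f : Dual R H) k • b) (by fun_prop)).symm
  apply evalTensor_injective (hU.congr D.equiv)
  refine Eq.trans ?_ (map_zero (evalTensor U B)).symm
  ext1 k
  simp [key, hx, sw_zero]

theorem exists_tensorAct (hS : IsTwistedAntipode S) (hσ' : IsConvInverse σ σ')
    (hVU : IsCompatible S act σ σ' V U) (x : SmashProduct ρ U) :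
    ∃ y : A ⊗[R] HopfSmash U, ∀ k,
      D.rightEquiv S σ' (tensorAct A U y (1 ⊗ₜ k)) = smashAct ρ U x (D.δ S σ' k) := by
  -- For t = a ⊗ g the sum is δ(y ↼ g)a with y = h(f ⇀ k), and the RL-condition applies to g.
  have h₁ (t : A ⊗[R] V) (h : H) (f : U.toNonUnitalSubalgebra) : ∃ y : A ⊗[R] HopfSmash U, ∀ k,
      D.rightEquiv S σ' (tensorAct A U y (1 ⊗ₜ k)) =
        sw R (h * leftHit (f : Dual R H) k) fun y₁ y₂ =>
          D.δ S σ' y₂ * D.ι (canonicalMap A V t y₁) := by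
    induction t with
    | zero => exact ⟨0, fun k => by simp [sw_zero]⟩
    | add s t hs ht =>
      obtain ⟨x, hx⟩ := hs
      obtain ⟨y, hy⟩ := ht
      exact ⟨x + y, fun k => by simp [hx, hy, sw_add, mul_add]⟩
    | tmul a g =>
      obtain ⟨z, hz⟩ : ∃ z : HopfSmash U, smashAct comul U z = rightHit (g : Dual R H) :=
        hVU.rl g g.2
      obtain ⟨z₁, hz₁⟩ := exists_smashAct_mul_arg z h
      obtain ⟨z₂, hz₂⟩ := exists_smashAct_leftHit z₁ f
      refine ⟨a ⊗ₜ z₂, fun k => ?_⟩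
      rw [tensorAct_tmul, rightEquiv_tmul, mul_one]
      have : smashAct comul U z₂ k = rightHit (g : Dual R H) (h * leftHit (f : Dual R H) k) := by
        rw [← hz, hz₁, hz₂]
      rw [this, rightHit_apply, map_sw, sw_mul]
      simp [canonicalMap]
  induction x using SmashProduct.induction with
  | zero => exact ⟨0, fun k => by simp⟩
  | add x y hx hy =>
    obtain ⟨x', hx⟩ := hx
    obtain ⟨y', hy⟩ := hy
    exact ⟨x' + y', fun k => by simp [hx, hy]⟩
  | mk b f =>
    obtain ⟨b, rfl⟩ := D.equiv.surjective b
    induction b with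
    | zero => exact ⟨0, fun k => by simp [smashAct_δ]⟩
    | add b c hb hc =>
      obtain ⟨x', hx⟩ := hb
      obtain ⟨y', hy⟩ := hc
      refine ⟨x' + y', fun k => ?_⟩
      simp only [smashAct_δ] at hx hy
      simp [smashAct_δ, hx, hy, add_mul]
    | tmul a h =>
      have h₂ (h₁' h₂' : H) : ∃ y : A ⊗[R] HopfSmash U, ∀ k,
          D.rightEquiv S σ' (tensorAct A U y (1 ⊗ₜ k)) =
            sw R (h₂' * leftHit (f : Dual R H) k) fun y₁ y₂ =>
              D.δ S σ' y₂ * D.ι (phi S act σ h₁' a y₁) := by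
        obtain ⟨t, ht⟩ := hVU.phi_mem h₁' a
        simpa only [ht] using h₁ t h₂' f
      choose Y hY using h₂
      refine ⟨sw R h Y, fun k => ?_⟩
      rw [smashAct_δ, D.equiv_tmul, D.mul_δ hS hσ']
      simp only [map_sw, map_sw_apply, hY]

theorem exists_smashAct (hS : IsTwistedAntipode S) (hσ' : IsConvInverse σ σ')
    (hVU : IsCompatible S act σ σ' V U) (y : A ⊗[R] HopfSmash U) :
    ∃ x : SmashProduct ρ U, ∀ k,
      smashAct ρ U x (D.δ S σ' k) = D.rightEquiv S σ' (tensorAct A U y (1 ⊗ₜ k)) := by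
  have h₁ (z : HopfSmash U) (a : A) (f : U.toNonUnitalSubalgebra) :
      ∃ x : SmashProduct ρ U, ∀ k, smashAct ρ U x (D.δ S σ' k) = D.ι a *
        sw R (leftHit (f : Dual R H) k) fun u v => sw R v (fun k₁ k₂ =>
          D.γ (smashAct comul U z k₂ * S k₁)) * D.δ S σ' u := by
    induction z using SmashProduct.induction with
    | zero => exact ⟨0, fun k => by simp [sw_zero]⟩
    | add s t hs ht =>
      obtain ⟨x, hx⟩ := hs
      obtain ⟨y, hy⟩ := ht
      exact ⟨x + y, fun k => by simp [hx, hy, sw_add, mul_add, add_mul]⟩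
    | mk h g =>
      refine ⟨SmashProduct.mk ρ U (D.ι a * D.γ h) (g * f), fun k => ?_⟩
      simp only [smashAct_mk, dualHit_comul, D.sw_leftHit hS, dualHit_δ]
      have e : leftHit (g : Dual R H) (leftHit (f : Dual R H) k) =
          leftHit ((g * f : U.toNonUnitalSubalgebra) : Dual R H) k :=
        dualHit_mul coassoc_apply _ _ _
      rw [e, mul_assoc]
  -- For t = a ⊗ g the inner sum over y₁, y₂ is ι(a)γ(((hk₂) ↼ g)S(k₁)). The RL-condition replaces ↼
  -- g by an element of H # U, and `h₁` applies.
  have h₂ (t : A ⊗[R] V) (h : H) (f : U.toNonUnitalSubalgebra) : ∃ x : SmashProduct ρ U, ∀ k,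
      smashAct ρ U x (D.δ S σ' k) = sw R (leftHit (f : Dual R H) k) fun u v =>
        sw R v (fun k₁ k₂ => sw R (h * k₂) fun y₁ y₂ =>
          D.ι (canonicalMap A V t y₁) * D.γ (y₂ * S k₁)) * D.δ S σ' u := by
    induction t with
    | zero => exact ⟨0, fun k => by simp [sw_zero]⟩
    | add s t hs ht =>
      obtain ⟨x, hx⟩ := hs
      obtain ⟨y, hy⟩ := ht
      exact ⟨x + y, fun k => by simp [hx, hy, sw_add, add_mul]⟩
    | tmul a g =>
      obtain ⟨z, hz⟩ : ∃ z : HopfSmash U, smashAct comul U z = rightHit (g : Dual R H) :=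
        hVU.rl g g.2
      obtain ⟨z₁, hz₁⟩ := exists_smashAct_mul_arg z h
      obtain ⟨x, hx⟩ := h₁ z₁ a f
      refine ⟨x, fun k => ?_⟩
      simp only [hx, ← hz₁, hz, rightHit_apply, sw_mul, map_sw, mul_sw]
      simp [canonicalMap, mul_assoc]
  induction y with
  | zero => exact ⟨0, fun k => by simp⟩
  | add x y hx hy =>
    obtain ⟨x', hx⟩ := hx
    obtain ⟨y', hy⟩ := hy
    exact ⟨x' + y', fun k => by simp [hx, hy]⟩
  | tmul a z =>
    induction z using SmashProduct.induction with
    | zero => exact ⟨0, fun k => by simp⟩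
    | add x y hx hy =>
      obtain ⟨x', hx⟩ := hx
      obtain ⟨y', hy⟩ := hy
      exact ⟨x' + y', fun k => by simp [hx, hy, TensorProduct.tmul_add]⟩
    | mk h f =>
      have h₃ (h₁' h₂' : H) : ∃ x : SmashProduct ρ U, ∀ k,
          smashAct ρ U x (D.δ S σ' k) = sw R (leftHit (f : Dual R H) k) fun u v =>
            sw R v (fun k₁ k₂ => sw R (h₂' * k₂) fun y₁ y₂ =>
              D.ι (psi S act σ σ' h₁' a y₁) * D.γ (y₂ * S k₁)) * D.δ S σ' u := by
        obtain ⟨t, ht⟩ := hVU.psi_mem h₁' a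
        simpa only [ht] using h₂ t h₂' f
      choose X hX using h₃
      refine ⟨sw R h X, fun k => ?_⟩
      rw [tensorAct_tmul, mul_one, smashAct_mk, dualHit_comul, rightEquiv_tmul, D.δ_mul_ι hS hσ']
      simp only [map_sw, map_sw_apply, hX]

include D in
theorem counit_ρ (b : B) : counit.lTensor B (ρ b) = b ⊗ₜ[R] (1 : R) := by
  have : counit.lTensor B ∘ₗ ρ = (TensorProduct.mk R B R).flip 1 := by
    refine D.ext fun a h => ?_
    simp only [LinearMap.comp_apply, D.ρ_ι_γ, map_sw, LinearMap.lTensor_tmul]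
    have := sw_counit_right (R := R) (h := h) (f := fun x => (D.ι a * D.γ x) ⊗ₜ[R] (1 : R))
      (by fun_prop)
    simpa only [← TensorProduct.tmul_smul, smul_eq_mul, mul_one, LinearMap.flip_apply,
      TensorProduct.mk_apply] using this
  exact LinearMap.congr_fun this b

theorem comp_rightEquiv_eq {x : SmashProduct ρ U} {y : A ⊗[R] HopfSmash U}
    (h : ∀ k, smashAct ρ U x (D.δ S σ' k) = D.rightEquiv S σ' (tensorAct A U y (1 ⊗ₜ k))) :
    smashAct ρ U x ∘ₗ D.rightEquiv S σ' = D.rightEquiv S σ' ∘ₗ tensorAct A U y := by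
  ext c k
  simp only [TensorProduct.AlgebraTensorModule.curry_apply, TensorProduct.curry_apply,
    LinearMap.coe_restrictScalars, LinearMap.comp_apply]
  rw [rightEquiv_tmul, D.smashAct_mul_ι, h, tensorAct_mulRight y c, rightEquiv_mulRight]

include D in
theorem exists_duality_iso [IsNoetherianRing R] (hS : IsTwistedAntipode S)
    (hσ' : IsConvInverse σ σ') (hVU : IsCompatible S act σ σ' V U)
    (hU : IsPureFor (inFunctions U.sub) (A ⊗[R] H)) :
    ∃ Θ : SmashProduct ρ U →ₙₐ[R] A ⊗[R] HopfSmash U, Function.Bijective Θ ∧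
      ∀ hε : (1 : Dual R H) ∈ U.toNonUnitalSubalgebra,
        Θ (SmashProduct.mk ρ U 1 ⟨1, hε⟩) = (1 : A) ⊗ₜ[R] SmashProduct.mk comul U 1 ⟨1, hε⟩ := by
  -- The images are compared in Hom(A ⊗ H, B), by composing with `rightEquiv` on either side, so its
  -- injectivity is enough.
  let f : SmashProduct ρ U →ₗ[R] (A ⊗[R] H →ₗ[R] B) :=
    LinearMap.lcomp R B (D.rightEquiv S σ') ∘ₗ smashAct ρ U
  let g : A ⊗[R] HopfSmash U →ₗ[R] (A ⊗[R] H →ₗ[R] B) :=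
    LinearMap.llcomp R _ _ _ (D.rightEquiv S σ') ∘ₗ tensorAct A U
  have hf_apply (x t) : f x t = smashAct ρ U x (D.rightEquiv S σ' t) := rfl
  have hg_apply (y t) : g y t = D.rightEquiv S σ' (tensorAct A U y t) := rfl
  have hinj := D.rightEquiv_injective hS hσ'
  have hf : Function.Injective f := by
    refine (injective_iff_map_eq_zero _).2 fun x hx => D.smashAct_injective hS hσ' hU fun k => ?_
    have := LinearMap.congr_fun hx (1 ⊗ₜ k)
    rwa [hf_apply, rightEquiv_tmul, map_one, mul_one] at this
  have hg : Function.Injective g := by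
    refine (injective_iff_map_eq_zero _).2 fun y hy => tensorAct_injective hS hU fun k => ?_
    apply hinj
    rw [map_zero]
    exact LinearMap.congr_fun hy (1 ⊗ₜ k)
  obtain ⟨e, he⟩ := exists_linearEquiv_of_range_eq hf hg
    (fun x => (D.exists_tensorAct hS hσ' hVU x).imp fun y hy =>
      (D.comp_rightEquiv_eq fun k => (hy k).symm).symm)
    (fun y => (D.exists_smashAct hS hσ' hVU y).imp fun x hx => D.comp_rightEquiv_eq hx)
  have he' (x t) : D.rightEquiv S σ' (tensorAct A U (e x) t) =
      smashAct ρ U x (D.rightEquiv S σ' t) := LinearMap.congr_fun (he x) t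
  have hmul (x y) : e (x * y) = e x * e y := by
    apply hg
    refine LinearMap.ext fun t => ?_
    rw [hg_apply, he', smashAct_mul D.ρ_mul D.ρ_coassoc, LinearMap.comp_apply, ← he', ← he',
      ← LinearMap.comp_apply (f := tensorAct A U (e x)), ← tensorAct_mul, hg_apply]
  refine ⟨{ e.toLinearMap with
    map_zero' := e.map_zero
    map_mul' := hmul }, e.bijective, fun hε => hg ?_⟩
  refine (he _).trans (LinearMap.ext fun t => ?_)
  rw [hf_apply, hg_apply, smashAct_mk, dualHit_one D.counit_ρ, one_mul]
  congr 1
  induction t with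
  | zero => simp
  | add s t hs ht => rw [map_add, ← hs, ← ht]
  | tmul a k =>
    rw [tensorAct_tmul, one_mul, smashAct_mk, dualHit_one lTensor_counit_comul, one_mul]

end NormalBasis

/-! ### Crossed products have a normal basis -/

section CrossedProductRing

variable {R : Type u} {H : Type v} {A : Type w} [CommRing R] [Ring H] [Bialgebra R H] [Ring A]
  [Algebra R A] {act : H →ₗ[R] A →ₗ[R] A} {σ : H ⊗[R] H →ₗ[R] A}

theorem crossedMul_eq_sw (act : H →ₗ[R] A →ₗ[R] A) (σ : H ⊗[R] H →ₗ[R] A) (a b : A) (h k : H) :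
    crossedMul act σ (a ⊗ₜ[R] h) (b ⊗ₜ[R] k) = sw R h fun x y => sw R y fun u v =>
      sw R k fun z w => (a * act x b * σ (u ⊗ₜ[R] z)) ⊗ₜ[R] (v * w) :=
  crossedMul_tmul act σ a b h k (ℛ R h) (fun _ => ℛ R _) (ℛ R k)

theorem crossedMul_tmul_tmul_one (act : H →ₗ[R] A →ₗ[R] A) (σ : H ⊗[R] H →ₗ[R] A) (a b : A)
    (h : H) : crossedMul act σ (a ⊗ₜ[R] h) (b ⊗ₜ[R] 1) =
      sw R h fun x y => sw R y fun u v => (a * act x b * σ (u ⊗ₜ[R] 1)) ⊗ₜ[R] v := by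
  simp (disch := fun_prop) only [crossedMul_eq_sw, sw_one_arg, mul_one]

theorem coaction_tmul (act : H →ₗ[R] A →ₗ[R] A) (σ : H ⊗[R] H →ₗ[R] A) (a : A) (h : H) :
    CrossedProduct.coaction act σ (a ⊗ₜ[R] h : A ⊗[R] H) =
      sw R h fun x y => (a ⊗ₜ[R] x : A ⊗[R] H) ⊗ₜ[R] y := by
  change (TensorProduct.assoc R A H H).symm (comul.lTensor A (a ⊗ₜ h)) = _
  simp only [LinearMap.lTensor_tmul, comul_eq_sw, tmul_sw, map_sw]
  rfl

namespace IsCrossedProduct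

variable (hσ : IsCrossedProduct act σ)
include hσ

theorem crossedMul_tmul_one_tmul (a b : A) (k : H) :
    crossedMul act σ (a ⊗ₜ[R] 1) (b ⊗ₜ[R] k) =
      sw R k fun z w => (a * b * σ (1 ⊗ₜ[R] z)) ⊗ₜ[R] w := by
  simp (disch := fun_prop) only [crossedMul_eq_sw, sw_one_arg, hσ.weak.one_act, _root_.one_mul]

theorem act_one (h : H) : act h 1 = counit (R := R) h • 1 := by
  have := LinearMap.congr_fun (congrArg WithConv.ofConv hσ.weak.map_one) h
  simpa [LinearMap.convOne_def, Algebra.algebraMap_eq_smul_one] using this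

/-- The unit axiom forces σ to be normalized: apply id ⊗ ε to (1 # 1)(1 # h) = 1 # h. -/
theorem cocycle_one_left (h : H) : σ (1 ⊗ₜ h) = counit (R := R) h • 1 := by
  have h₁ : crossedMul act σ (1 ⊗ₜ[R] 1) (1 ⊗ₜ[R] h) = 1 ⊗ₜ h := hσ.one_mul _
  rw [hσ.crossedMul_tmul_one_tmul] at h₁
  have h₂ := congrArg (TensorProduct.rid R A ∘ counit.lTensor A) h₁
  simp only [Function.comp_apply, map_sw, LinearMap.lTensor_tmul, TensorProduct.rid_tmul,
    _root_.one_mul] at h₂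
  rw [← h₂]
  exact (sw_counit_right (R := R) (f := fun z => σ (1 ⊗ₜ z)) (by fun_prop)).symm

theorem cocycle_one_right (h : H) : σ (h ⊗ₜ 1) = counit (R := R) h • 1 := by
  have h₁ : crossedMul act σ (1 ⊗ₜ[R] h) (1 ⊗ₜ[R] 1) = 1 ⊗ₜ h := hσ.mul_one _
  have h₂ := congrArg (TensorProduct.rid R A ∘ counit.lTensor A) h₁
  simp only [crossedMul_tmul_tmul_one, hσ.act_one, Function.comp_apply, map_sw,
    LinearMap.lTensor_tmul, TensorProduct.rid_tmul, smul_mul_assoc, _root_.one_mul] at h₂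
  rw [← h₂]
  have e (x y : H) : sw R y (fun u v => counit (R := R) v • counit (R := R) x • σ (u ⊗ₜ 1)) =
      counit (R := R) x • σ (y ⊗ₜ 1) :=
    sw_counit_right (R := R) (f := fun u => counit (R := R) x • σ (u ⊗ₜ 1)) (by fun_prop)
  simp only [e]
  exact (sw_counit_left (R := R) (f := fun z => σ (z ⊗ₜ 1)) (by fun_prop)).symm

/-- A crossed product is a ring. -/
abbrev ring : Ring (CrossedProduct act σ) :=
  { (inferInstance : NonUnitalNonAssocRing (CrossedProduct act σ)),
    (inferInstance : One (CrossedProduct act σ)) with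
    mul_assoc := hσ.mul_assoc
    one_mul := hσ.one_mul
    mul_one := hσ.mul_one }

/-- A crossed product is an algebra. -/
abbrev algebra : @Algebra R (CrossedProduct act σ) _ hσ.ring.toSemiring :=
  letI := hσ.ring
  Algebra.ofModule smul_mul_assoc mul_smul_comm

theorem crossedMul_tmul_one_one_tmul (a : A) (k : H) :
    crossedMul act σ (a ⊗ₜ[R] 1) (1 ⊗ₜ[R] k) = a ⊗ₜ k := by
  rw [hσ.crossedMul_tmul_one_tmul]
  simp only [hσ.cocycle_one_left, _root_.mul_one, mul_smul_comm, ← TensorProduct.smul_tmul']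
  exact sw_counit_left (R := R) (f := fun z => a ⊗ₜ[R] z) (by fun_prop)

theorem crossedMul_tmul_one_tmul_one (a b : A) :
    crossedMul act σ (a ⊗ₜ[R] 1) (b ⊗ₜ[R] 1) = (a * b) ⊗ₜ 1 := by
  rw [hσ.crossedMul_tmul_one_tmul, sw_one_arg (by fun_prop) (by fun_prop), hσ.cocycle_one_left]
  simp

theorem crossedMul_one_tmul_tmul_one (h : H) (a : A) :
    crossedMul act σ (1 ⊗ₜ[R] h) (a ⊗ₜ[R] 1) = sw R h fun x y => act x a ⊗ₜ[R] y := by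
  have e (x y : H) := sw_counit_left (R := R) (h := y) (f := fun v => act x a ⊗ₜ[R] v)
    (by fun_prop)
  simp only [crossedMul_tmul_tmul_one, _root_.one_mul, hσ.cocycle_one_right, mul_smul_comm,
    _root_.mul_one, ← TensorProduct.smul_tmul', e]

theorem crossedMul_one_tmul_one_tmul (h k : H) : crossedMul act σ (1 ⊗ₜ[R] h) (1 ⊗ₜ[R] k) =
    sw R h fun x y => sw R k fun z w => σ (x ⊗ₜ z) ⊗ₜ[R] (y * w) := by
  simp only [crossedMul_eq_sw, hσ.act_one, smul_mul_assoc, _root_.one_mul,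
    ← TensorProduct.smul_tmul', ← smul_sw]
  exact sw_counit_left (R := R) (f := fun y => sw R y fun u v => sw R k fun z w =>
    σ (u ⊗ₜ[R] z) ⊗ₜ[R] (v * w)) (by fun_prop)

/-- The normal basis of a crossed product. -/
def normalBasis :
    @NormalBasis R H A _ _ _ _ _ act σ (CrossedProduct act σ) hσ.ring hσ.algebra
      (CrossedProduct.coaction act σ) :=
  letI := hσ.ring
  letI := hσ.algebra
  let ι : A →ₐ[R] CrossedProduct act σ := AlgHom.ofLinearMap
    ((TensorProduct.mk R A H).flip 1 : A →ₗ[R] A ⊗[R] H) rfl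
    fun a b => (hσ.crossedMul_tmul_one_tmul_one a b).symm
  let γ : H →ₗ[R] CrossedProduct act σ := (TensorProduct.mk R A H 1 : H →ₗ[R] A ⊗[R] H)
  have hιγ (a : A) (h : H) : ι a * γ h = (a ⊗ₜ[R] h : A ⊗[R] H) :=
    hσ.crossedMul_tmul_one_one_tmul a h
  { ι := ι
    γ := γ
    toA := ((TensorProduct.rid R A).toLinearMap ∘ₗ counit.lTensor A : A ⊗[R] H →ₗ[R] A)
    equiv := LinearEquiv.refl R (A ⊗[R] H)
    equiv_tmul := fun a h => (hιγ a h).symm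
    toA_ι_γ := fun a h => by
      rw [hιγ]
      rfl
    γ_one := rfl
    γ_ι := fun h a => (hσ.crossedMul_one_tmul_tmul_one h a).trans <|
      congrArg (sw R h) (funext₂ fun x y => (hιγ (act x a) y).symm)
    γ_γ := fun h k => (hσ.crossedMul_one_tmul_one_tmul h k).trans <|
      congrArg (sw R h) (funext₂ fun x y => congrArg (sw R k) (funext₂ fun z w =>
        (hιγ (σ (x ⊗ₜ z)) (y * w)).symm))
    ρ_ι_γ := fun a h => (congrArg (CrossedProduct.coaction act σ) (hιγ a h)).trans <|
      (coaction_tmul act σ a h).trans <|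
      congrArg (sw R h) (funext₂ fun x y => congrArg (· ⊗ₜ[R] y) (hιγ a x).symm) }

end IsCrossedProduct

end CrossedProductRing

end HopfDuality

end

open HopfDuality in
theorem mainTheorem1 {R : Type u} {H : Type v} {A : Type w}
    [CommRing R] [IsNoetherianRing R] [Ring H] [HopfAlgebra R H] [Ring A] [Algebra R A]
    (S : H →ₗ[R] H) (hS : IsTwistedAntipode S)
    (act : H →ₗ[R] A →ₗ[R] A) (σ σ' : H ⊗[R] H →ₗ[R] A)
    (hσ : IsCrossedProduct act σ) (hσ' : IsConvInverse σ σ')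
    (U : RightModuleSubalgebra R H)
    (V : Submodule R (Dual R H)) (hV : ∀ g ∈ V, ∀ h : H, dualAct R H g h ∈ V)
    (hVU : IsCompatible S act σ σ' V U) :
    (IsPureFor (inFunctions U.sub) (A ⊗[R] H) →
      ∃ Θ : SmashProduct (CrossedProduct.coaction act σ) U →ₙₐ[R] A ⊗[R] HopfSmash U,
        Function.Bijective Θ ∧
        ∀ hε : (1 : Dual R H) ∈ U.toNonUnitalSubalgebra,
          Θ (SmashProduct.mk _ U 1 ⟨1, hε⟩) = (1 : A) ⊗ₜ[R] SmashProduct.mk _ U 1 ⟨1, hε⟩) ∧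
    (IsAlphaAlgebra.{u, v, max u v w} R H → IsSubbialgebraOfFiniteDual.{u, v, max u v w} U →
      IsPureFor (inFunctions U.sub) (A ⊗[R] H)) := by
  refine ⟨fun hU => ?_, fun hH hUH => ?_⟩
  · let := hσ.ring
    let := hσ.algebra
    exact hσ.normalBasis.exists_duality_iso hS hσ' hVU hU
  -- `ULift` brings A ⊗ H into the universe over which the purity hypotheses quantify.
  · exact (isPureFor_of_isSubbialgebraOfFiniteDual hH hUH (ULift.{u} (A ⊗[R] H))).congr
      ULift.moduleEquiv
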